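/- Identify $\mathbb R^2$ with $\mathbb C$, let $\mathbb L^3=\mathbb C\times\mathbb R$ carry the Lorentzian product $\langle(z,x),(w,y)\rangle=\operatorname{Re}(z\bar w)-xy$, let $\mathbb H^2=\{p\in\mathbb L^3:\langle p,p\rangle=-1,\ p_3>0\}$ be the hyperbolic plane, and let $\ell=\{o\}\times\mathbb R\subset\mathbb H^2\times\mathbb R$ be the vertical axis through $o=(0,1)$. A generating curve is a smooth curve $\sigma=(\alpha,\phi):\mathbb R\to\mathbb H^2$ with $|\alpha'|=1$. For $h>0$, the helicoidal surface of pitch $h$ generated by $\sigma$ is $X(u,v)=(e^{iv}\alpha(u),\phi(u),hv)$, $(u,v)\in\mathbb R^2$. A surface in $\mathbb H^2\times\mathbb R$ with unit normal $\eta$ and mean curvature $H$ (half the trace of the second fundamental form) is a rotator to mean curvature flow if $H=\langle J\pi,\eta\rangle$ on it, where $J\pi$ is the Killing field $(z,x,t)\mapsto(iz,0,0)$ of the rotations about $\ell$. **Theorem.** Let $h>0$. (i) There is a one-parameter family $(\sigma_c)_{c\ge 0}$ of generating curves, with $(c,s)\mapsto\sigma_c(s)$ continuous, such that for every $c\ge0$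 the helicoidal surface of pitch $h$ generated by $\sigma_c$ is a rotator to mean curvature flow, and the least distance in $\mathbb H^2$ from $o$ to a point of $\sigma_c$ is exactly $c$. (ii) Let $\sigma$ be any generating curve whose helicoidal surface of pitch $h$ is a rotator to mean curvature flow (in particular, any $\sigma_c$ from (i)). Then the surface is complete in its induced metric. Moreover there is a unique parameter $s_0$ at which $\sigma$ is closest to $o$, and the trace of $\sigma$ consists of the two arms $t\mapsto\sigma(s_0+t)$ and $t\mapsto\sigma(s_0-t)$, $t\ge0$, issuing from the point $p_0=\sigma(s_0)$. Each arm is embedded, proper in $\mathbb H^2$, and its distance to $o$ tends to $+\infty$. Each arm spirals around $o$ and also around its initial point $p_0$: for $q\in\{o,p_0\}$, the arm does not meet $q$ for $t>0$, and a continuous angle function along it in positively oriented geodesic polar coordinates of $\mathbb H^2$ about $q$ tends to $+\infty$ as $t\to+\infty$. (So the angle of $\sigma(s)$ about $q$ tends to $+\infty$ both as $s\to+\infty$ and as $s\to-\infty$.) -/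

import Mathlib

open Set Filter Topology
open scoped NNReal ENNReal ContDiff

/- The Lorentzian space `L³` is `ℂ × ℝ`: the plane `{e₃}ᗮ = ℝ²` is identified with `ℂ`, so that the
quarter turn `J` is multiplication by `I` and `e^{vJ}` is multiplication by `e^{iv}`. -/

namespace HelicoidalRotator

/-- The Lorentzian inner product `x₁ y₁ + x₂ y₂ - x₃ y₃` of `L³ = ℂ × ℝ`. -/
def lorentz (x y : ℂ × ℝ) : ℝ := x.1.re * y.1.re + x.1.im * y.1.im - x.2 * y.2

/-- The hyperbolic plane, in the hyperboloid model. -/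
def hyperbolicPlane : Set (ℂ × ℝ) := {p | lorentz p p = -1 ∧ 0 < p.2}

/-- The point of `ℍ²` on the vertical rotation axis `{(0, 0, 1)} × ℝ`. -/
def axisPoint : ℂ × ℝ := (0, 1)

/-- The distance of `ℍ²`: `cosh d(p, q) = -⟨p, q⟩`. -/
noncomputable def hypDist (p q : ℂ × ℝ) : ℝ := Real.arcosh (-lorentz p q)

/-- The inner product of `L³ × ℝ`, which induces the product metric of `ℍ² × ℝ`. -/
def inner4 (x y : (ℂ × ℝ) × ℝ) : ℝ := lorentz x.1 y.1 + x.2 * y.2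

/-- The rotations `Γ_t` of `ℍ² × ℝ` about the vertical axis. -/
noncomputable def rotation (t : ℝ) (p : (ℂ × ℝ) × ℝ) : (ℂ × ℝ) × ℝ :=
  ((Complex.exp (t * Complex.I) * p.1.1, p.1.2), p.2)

/-- The Killing field `ξ = Jπ` of the group of rotations. -/
noncomputable def killing (p : (ℂ × ℝ) × ℝ) : (ℂ × ℝ) × ℝ := ((Complex.I * p.1.1, 0), 0)

theorem hasDerivAt_rotation (p : (ℂ × ℝ) × ℝ) :
    HasDerivAt (fun t => rotation t p) (killing p) 0 := by
  have h1 : HasDerivAt (fun t : ℝ => Complex.exp (t * Complex.I) * p.1.1)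
      (Complex.I * p.1.1) 0 := by
    have h2 : HasDerivAt (fun t : ℝ => (t : ℂ) * Complex.I) (1 * Complex.I) 0 :=
      (HasDerivAt.ofReal_comp (hasDerivAt_id (0 : ℝ))).mul_const _
    simpa using h2.cexp.mul_const p.1.1
  exact (h1.prodMk (hasDerivAt_const _ _)).prodMk (hasDerivAt_const _ _)

section Surfaces

/-- `∂X/∂u` -/
noncomputable def partialU (X : ℝ × ℝ → (ℂ × ℝ) × ℝ) (p : ℝ × ℝ) : (ℂ × ℝ) × ℝ :=
  deriv (fun u => X (u, p.2)) p.1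

/-- `∂X/∂v` -/
noncomputable def partialV (X : ℝ × ℝ → (ℂ × ℝ) × ℝ) (p : ℝ × ℝ) : (ℂ × ℝ) × ℝ :=
  deriv (fun v => X (p.1, v)) p.2

/-- The coefficients of the first fundamental form. -/
noncomputable def coeffE (X : ℝ × ℝ → (ℂ × ℝ) × ℝ) (p : ℝ × ℝ) : ℝ :=
  inner4 (partialU X p) (partialU X p)

noncomputable def coeffF (X : ℝ × ℝ → (ℂ × ℝ) × ℝ) (p : ℝ × ℝ) : ℝ :=
  inner4 (partialU X p) (partialV X p)

noncomputable def coeffG (X : ℝ × ℝ → (ℂ × ℝ) × ℝ) (p : ℝ × ℝ) : ℝ :=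
  inner4 (partialV X p) (partialV X p)

/-- `X` is a smoothly immersed parametrized surface of `ℍ² × ℝ`. -/
structure IsImmersedSurface (X : ℝ × ℝ → (ℂ × ℝ) × ℝ) : Prop where
  smooth : ContDiff ℝ ∞ X
  mem : ∀ p, (X p).1 ∈ hyperbolicPlane
  immersion : ∀ p, 0 < coeffE X p * coeffG X p - coeffF X p ^ 2

/-- `η` is a (continuous) unit normal field of the surface `X` in `ℍ² × ℝ`. The vector `η p` is
tangent to `ℍ² × ℝ` at `X p`, has length one, and is orthogonal to the surface. -/
structure IsUnitNormal (X η : ℝ × ℝ → (ℂ × ℝ) × ℝ) : Prop where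
  continuous : Continuous η
  tangent : ∀ p, lorentz (X p).1 (η p).1 = 0
  unit : ∀ p, inner4 (η p) (η p) = 1
  orthogonalU : ∀ p, inner4 (partialU X p) (η p) = 0
  orthogonalV : ∀ p, inner4 (partialV X p) (η p) = 0

/-- The mean curvature `(E g - 2 f F + G e) / (2 (E G - F²))` with respect to `η`. The flat
derivatives of `L³ × ℝ` differ from the covariant derivatives of `ℍ² × ℝ` by a multiple of the
position vector of `ℍ²`, to which `η` is orthogonal; so they give the second fundamental form
`e, f, g` of the surface in `ℍ² × ℝ`. -/
noncomputable def meanCurvature (X η : ℝ × ℝ → (ℂ × ℝ) × ℝ) (p : ℝ × ℝ) : ℝ :=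
  (coeffE X p * inner4 (partialV (partialV X) p) (η p)
      - 2 * inner4 (partialV (partialU X) p) (η p) * coeffF X p
      + coeffG X p * inner4 (partialU (partialU X) p) (η p))
    / (2 * (coeffE X p * coeffG X p - coeffF X p ^ 2))

/-- The surface `X` of `ℍ² × ℝ` is a rotator to mean curvature flow: `H = ⟨Jπ, η⟩`. -/
def IsRotator (X : ℝ × ℝ → (ℂ × ℝ) × ℝ) : Prop :=
  IsImmersedSurface X ∧ ∃ η, IsUnitNormal X η ∧
    ∀ p, meanCurvature X η p = inner4 (killing (X p)) (η p)

/-- The length in the induced metric of the path `γ`, `0 ≤ t ≤ 1`, of the parameter plane. -/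
noncomputable def inducedLength (X : ℝ × ℝ → (ℂ × ℝ) × ℝ) (γ : ℝ → ℝ × ℝ) : ℝ≥0∞ :=
  ∫⁻ t in Icc (0 : ℝ) 1,
    ENNReal.ofReal (√(inner4 (deriv (fun x => X (γ x)) t) (deriv (fun x => X (γ x)) t)))

/-- The intrinsic distance of the surface `X`. -/
noncomputable def intrinsicDist (X : ℝ × ℝ → (ℂ × ℝ) × ℝ) (p q : ℝ × ℝ) : ℝ≥0∞ :=
  ⨅ (γ : ℝ → ℝ × ℝ) (_ : ContDiff ℝ 1 γ ∧ γ 0 = p ∧ γ 1 = q), inducedLength X γ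

/-- The surface `X` is complete for its intrinsic distance. -/
def IsCompleteSurface (X : ℝ × ℝ → (ℂ × ℝ) × ℝ) : Prop :=
  ∀ x : ℕ → ℝ × ℝ,
    (∀ ε : ℝ≥0∞, 0 < ε → ∃ N, ∀ m ≥ N, ∀ n ≥ N, intrinsicDist X (x m) (x n) < ε) →
      ∃ p, Tendsto (fun n => intrinsicDist X (x n) p) atTop (𝓝 0)

end Surfaces

section Curves

/-- `σ = (α, φ)` is a smooth curve of `ℍ²`, defined on the whole line, whose plane projection `α`
is parametrized by arc length. -/
structure IsGeneratingCurve (σ : ℝ → ℂ × ℝ) : Prop where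
  smooth : ContDiff ℝ ∞ σ
  mem : ∀ s, σ s ∈ hyperbolicPlane
  arcLength : ∀ s, ‖deriv (fun x => (σ x).1) s‖ = 1

/-- The helicoidal surface `X(u, v) = (e^{vJ} α(u), φ(u), h v)` of pitch `h` generated by
`σ = (α, φ)`. -/
noncomputable def helicoidalSurface (h : ℝ) (σ : ℝ → ℂ × ℝ) (p : ℝ × ℝ) : (ℂ × ℝ) × ℝ :=
  ((Complex.exp (p.2 * Complex.I) * (σ p.1).1, (σ p.1).2), h * p.2)

/-- `(e₁, e₂)` is a positively oriented orthonormal basis of the tangent plane of `ℍ²` at `q`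
(at the axis point, `((1, 0), (I, 0))` is one). -/
structure IsFrame (q e₁ e₂ : ℂ × ℝ) : Prop where
  tangent₁ : lorentz q e₁ = 0
  tangent₂ : lorentz q e₂ = 0
  unit₁ : lorentz e₁ e₁ = 1
  unit₂ : lorentz e₂ e₂ = 1
  orthogonal : lorentz e₁ e₂ = 0
  positive : 0 < Matrix.det !![e₁.1.re, e₁.1.im, e₁.2; e₂.1.re, e₂.1.im, e₂.2; q.1.re, q.1.im, q.2]

/-- The arm `γ(t)`, `t ≥ 0`, is embedded and proper in `ℍ²` (a closed subset of `L³`), and unbounded: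
its points go to infinity. -/
def IsUnboundedProperArm (γ : ℝ → ℂ × ℝ) : Prop :=
  (∀ t ∈ Ici (0 : ℝ), γ t ∈ hyperbolicPlane) ∧
    IsClosedEmbedding (fun t : Ici (0 : ℝ) => γ t) ∧
    Tendsto (fun t => hypDist axisPoint (γ t)) atTop atTop

/-- The arm `γ(t)`, `t ≥ 0`, spirals around the point `q` of `ℍ²`: it does not meet `q` for `t > 0`,
and in geodesic polar coordinates `(ρ, θ)` of `ℍ²` about `q` the angle function `θ`, continuous
along the arm, tends to `+∞`. -/
def SpiralsAround (γ : ℝ → ℂ × ℝ) (q : ℂ × ℝ) : Prop :=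
  ∃ e₁ e₂, IsFrame q e₁ e₂ ∧ ∃ ρ θ : ℝ → ℝ,
    ContinuousOn θ (Ioi 0) ∧
    (∀ t > 0, 0 < ρ t ∧ γ t = Real.cosh (ρ t) • q
      + Real.sinh (ρ t) • (Real.cos (θ t) • e₁ + Real.sin (θ t) • e₂)) ∧
    Tendsto θ atTop atTop

/-- The trace of `σ` consists of two unbounded properly embedded arms that issue from the point
`σ s₀` of the curve closest to the rotation axis, and both arms spiral in this sense around the axis
point and around `σ s₀`. -/
def HasSpiralingArms (σ : ℝ → ℂ × ℝ) : Prop :=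
  ∃ s₀ : ℝ,
    (∀ s, s ≠ s₀ → hypDist axisPoint (σ s₀) < hypDist axisPoint (σ s)) ∧
    ∀ γ : ℝ → ℂ × ℝ, (γ = fun t => σ (s₀ + t)) ∨ (γ = fun t => σ (s₀ - t)) →
      IsUnboundedProperArm γ ∧ SpiralsAround γ axisPoint ∧ SpiralsAround γ (σ s₀)

end Curves

end HelicoidalRotator

/-! Let τ and μ be the components of the plane projection α along its unit tangent and the quarter
turn of that tangent. The normal of the helicoidal surface is explicit in τ, μ and the height, so H
= ⟨Jπ, η⟩ reduces pointwise to prescribing the curvature k of α as a function of (τ, μ)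
(`meanCurvature_eq_killing_iff`). With the Frenet equations this is the autonomous system τ' = 1 +
kμ, μ' = -kτ. Since k is bounded and smooth, the plane curves and their tangent angles form a
continuous global flow. Starting perpendicular to the position vector at distance c gives the family
(`exists_family`).

For r² = τ² + μ² the curvature cancels: (r²)' = 2τ. The decisive estimate is τ' ≥ m + 2τg with m =
min(1, h²) and g bounded (`growthRate_le_deriv`, `abs_growthRate_le`). An integrating factor shows
that τ vanishes at most once, changing sign from negative to positive; comparison with multiples of
r² shows that it does vanish, and that r² → ∞. The zero is the unique closest point.

Far out, k r² + μ ≥ (m/4)τ as long as μ ≥ -τ, which drives μ/τ below -1 for good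
(`eventually_le_neg`). Then the angle about o has derivative -μ/r² ≥ τ/r² = (½ log r²)' and
diverges. The directions of the moving point seen from o and from p₀ are never opposite, so the two
angles differ boundedly (`spiralsAround_of_angle`). Reversing the parameter treats the other arm.

Completeness comes from two functions that are Lipschitz for the induced metric, hv and a multiple
of arsinh u: together they bound Cauchy sequences in the parameter plane (`isCompleteSurface`). -/

namespace HelicoidalRotator

/-! ### Global flows of bounded vector fields. -/

section Flow

variable {E : Type*} [NormedAddCommGroup E] [NormedSpace ℝ E]

/-- On a compact time interval both trajectories stay in one ball, where a single Lipschitz constant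
is available for Grönwall uniqueness. -/
theorem eqOn_Ioo_of_hasDerivAt_of_lipschitzOn_balls {f : E → E}
    (hf : ∀ R : ℝ, ∃ K : ℝ≥0, LipschitzOnWith K f (Metric.closedBall 0 R)) {x y : ℝ → E} {a : ℝ}
    (ha : 0 < a) (hx : ContinuousOn x (Icc (-a) a)) (hy : ContinuousOn y (Icc (-a) a))
    (hx' : ∀ t ∈ Ioo (-a) a, HasDerivAt x (f (x t)) t)
    (hy' : ∀ t ∈ Ioo (-a) a, HasDerivAt y (f (y t)) t) (h0 : x 0 = y 0) :
    EqOn x y (Icc (-a) a) := by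
  obtain ⟨R₁, h₁⟩ := (isCompact_Icc.image_of_continuousOn hx).isBounded.subset_closedBall (0 : E)
  obtain ⟨R₂, h₂⟩ := (isCompact_Icc.image_of_continuousOn hy).isBounded.subset_closedBall (0 : E)
  obtain ⟨K, hK⟩ := hf (max R₁ R₂)
  refine ODE_solution_unique_of_mem_Icc (v := fun _ => f)
    (s := fun _ => Metric.closedBall 0 (max R₁ R₂)) (t₀ := 0) (fun _ _ => hK)
    ⟨by linarith, ha⟩ hx hx' (fun t ht => ?_) hy hy' (fun t ht => ?_) h0
  · exact Metric.closedBall_subset_closedBall (le_max_left _ _)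
      (h₁ (mem_image_of_mem _ (Ioo_subset_Icc_self ht)))
  · exact Metric.closedBall_subset_closedBall (le_max_right _ _)
      (h₂ (mem_image_of_mem _ (Ioo_subset_Icc_self ht)))

/-- A bounded vector field that is Lipschitz on balls has a continuous global flow. -/
theorem exists_continuous_flow [CompleteSpace E] {f : E → E} {L : ℝ≥0} (hL : ∀ x, ‖f x‖ ≤ L)
    (hf : ∀ R : ℝ, ∃ K : ℝ≥0, LipschitzOnWith K f (Metric.closedBall 0 R)) :
    ∃ Φ : E × ℝ → E, Continuous Φ ∧ (∀ x, Φ (x, 0) = x) ∧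
      ∀ x t, HasDerivAt (fun s => Φ (x, s)) (f (Φ (x, t))) t := by
  have key : ∀ n : ℕ, ∃ A : E × ℝ → E, (∀ x ∈ Metric.closedBall (0 : E) (n + 1), A (x, 0) = x ∧
      ∀ t ∈ Icc (-(n + 1 : ℝ)) (n + 1),
        HasDerivWithinAt (fun s => A (x, s)) (f (A (x, t))) (Icc (-(n + 1 : ℝ)) (n + 1)) t) ∧
      ContinuousOn A (Metric.closedBall (0 : E) (n + 1) ×ˢ Icc (-(n + 1 : ℝ)) (n + 1)) := by
    intro n
    -- Starting within n + 1 of the origin and moving at speed at most L for time n + 1, a solution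
    -- cannot leave this ball.
    obtain ⟨K, hK⟩ := hf ((L * (n + 1) + (n + 1) : ℝ≥0) : ℝ)
    have hp : IsPicardLindelof (fun _ => f) (tmin := -(n + 1 : ℝ)) (tmax := n + 1)
        ⟨0, by constructor <;> linarith [n.cast_nonneg (α := ℝ)]⟩ (0 : E)
        (L * (n + 1) + (n + 1)) ((n + 1 : ℝ≥0)) L K :=
      IsPicardLindelof.of_time_independent (fun x _ => hL x) hK (by simp)
    exact hp.exists_forall_mem_closedBall_eq_hasDerivWithinAt_continuousOn
  choose A hA hAc using key
  have hcont : ∀ n : ℕ, ∀ x ∈ Metric.closedBall (0 : E) (n + 1),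
      ContinuousOn (fun s => A n (x, s)) (Icc (-(n + 1 : ℝ)) (n + 1)) := fun n x hx =>
    HasDerivWithinAt.continuousOn (hA n x hx).2
  have hder : ∀ n : ℕ, ∀ x ∈ Metric.closedBall (0 : E) (n + 1),
      ∀ t ∈ Ioo (-(n + 1 : ℝ)) (n + 1), HasDerivAt (fun s => A n (x, s)) (f (A n (x, t))) t :=
    fun n x hx t ht => ((hA n x hx).2 t (Ioo_subset_Icc_self ht)).hasDerivAt
      (Icc_mem_nhds ht.1 ht.2)
  have agree : ∀ n m : ℕ, n ≤ m → ∀ x ∈ Metric.closedBall (0 : E) (n + 1),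
      ∀ t ∈ Icc (-(n + 1 : ℝ)) (n + 1), A m (x, t) = A n (x, t) := by
    intro n m hnm x hx
    have hc : (n : ℝ) ≤ m := Nat.cast_le.2 hnm
    have hx' : x ∈ Metric.closedBall (0 : E) (m + 1) :=
      Metric.closedBall_subset_closedBall (by linarith) hx
    have hn : (0 : ℝ) ≤ n := n.cast_nonneg
    have hsub : Icc (-(n + 1 : ℝ)) (n + 1) ⊆ Icc (-(m + 1 : ℝ)) (m + 1) :=
      Icc_subset_Icc (by linarith) (by linarith)
    have hsub' : Ioo (-(n + 1 : ℝ)) (n + 1) ⊆ Ioo (-(m + 1 : ℝ)) (m + 1) :=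
      Ioo_subset_Ioo (by linarith) (by linarith)
    refine eqOn_Ioo_of_hasDerivAt_of_lipschitzOn_balls hf (by linarith)
      ((hcont m x hx').mono hsub) (hcont n x hx) (fun t ht => hder m x hx' t (hsub' ht))
      (hder n x hx) ?_
    simp only [(hA m x hx').1, (hA n x hx).1]
  -- The local flow of index n lives on radius and time n + 1, so an index bounding both ‖x‖ and |t|
  -- places (x, t) in the interior, as continuity and two-sided derivatives require.
  let N : E × ℝ → ℕ := fun p => ⌈max ‖p.1‖ |p.2|⌉₊
  have hN : ∀ p : E × ℝ, ‖p.1‖ ≤ N p ∧ |p.2| ≤ N p := fun p =>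
    ⟨(le_max_left _ _).trans (Nat.le_ceil _), (le_max_right _ _).trans (Nat.le_ceil _)⟩
  have hΦ : ∀ n : ℕ, ∀ x ∈ Metric.closedBall (0 : E) (n + 1), ∀ t ∈ Icc (-(n + 1 : ℝ)) (n + 1),
      A (N (x, t)) (x, t) = A n (x, t) := by
    intro n x hx t ht
    rcases le_total n (N (x, t)) with hle | hle
    · exact agree n _ hle x hx t ht
    · refine (agree _ n hle x ?_ t ?_).symm
      · simpa using (hN (x, t)).1.trans (by simp)
      · have := abs_le.1 (hN (x, t)).2
        constructor <;> simp only at this <;> linarith [this.1, this.2]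
  have hmem : ∀ x : E, ∀ t : ℝ, ∃ n : ℕ, x ∈ Metric.ball (0 : E) (n + 1) ∧
      t ∈ Ioo (-(n + 1 : ℝ)) (n + 1) := by
    intro x t
    have h1 := (hN (x, t)).1
    have h2 := abs_le.1 (hN (x, t)).2
    simp only at h1 h2
    exact ⟨N (x, t), by rw [mem_ball_zero_iff]; linarith, by linarith, by linarith⟩
  refine ⟨fun p => A (N p) p, ?_, ?_, ?_⟩
  · rw [continuous_iff_continuousAt]
    rintro ⟨x, t⟩
    obtain ⟨n, hx, ht⟩ := hmem x t
    have hnhds : Metric.ball (0 : E) (n + 1) ×ˢ Ioo (-(n + 1 : ℝ)) (n + 1) ∈ 𝓝 (x, t) :=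
      prod_mem_nhds (Metric.isOpen_ball.mem_nhds hx) (isOpen_Ioo.mem_nhds ht)
    have hca : ContinuousAt (A n) (x, t) := (hAc n).continuousAt
      (mem_of_superset hnhds (prod_mono Metric.ball_subset_closedBall Ioo_subset_Icc_self))
    refine hca.congr ?_
    filter_upwards [hnhds] with p hp
    exact (hΦ n p.1 (Metric.ball_subset_closedBall hp.1) p.2 (Ioo_subset_Icc_self hp.2)).symm
  · intro x
    obtain ⟨n, hx, ht⟩ := hmem x 0
    beta_reduce
    rw [hΦ n x (Metric.ball_subset_closedBall hx) 0 (Ioo_subset_Icc_self ht)]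
    exact (hA n x (Metric.ball_subset_closedBall hx)).1
  · intro x t
    obtain ⟨n, hx, ht⟩ := hmem x t
    have hx := Metric.ball_subset_closedBall hx
    beta_reduce
    rw [hΦ n x hx t (Ioo_subset_Icc_self ht)]
    refine (hder n x hx t ht).congr_of_eventuallyEq ?_
    filter_upwards [isOpen_Ioo.mem_nhds ht] with s hs
    exact hΦ n x hx s (Ioo_subset_Icc_self hs)

theorem lipschitzOnWith_closedBall_of_contDiff [ProperSpace E] {f : E → E} (hf : ContDiff ℝ 1 f)
    (R : ℝ) : ∃ K : ℝ≥0, LipschitzOnWith K f (Metric.closedBall 0 R) :=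
  (hf.locallyLipschitz.locallyLipschitzOn).exists_lipschitzOnWith_of_compact
    (isCompact_closedBall 0 R)

/-- Integral curves of a smooth vector field are smooth. -/
theorem contDiff_of_hasDerivAt_comp {f : E → E} (hf : ContDiff ℝ ∞ f) {x : ℝ → E}
    (hx : ∀ t, HasDerivAt x (f (x t)) t) : ContDiff ℝ ∞ x := by
  have hd : Differentiable ℝ x := fun t => (hx t).differentiableAt
  have hderiv : deriv x = fun t => f (x t) := funext fun t => (hx t).deriv
  refine contDiff_infty.2 fun n => ?_
  induction n with
  | zero => exact contDiff_zero.2 hd.continuous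
  | succ n ih =>
    push_cast
    rw [contDiff_succ_iff_deriv]
    refine ⟨hd, by simp, ?_⟩
    rw [hderiv]
    exact (hf.of_le (by exact_mod_cast le_top)).comp ih

end Flow

/-! ### Qualitative analysis of the system for the tangential and normal components. -/

section TangentialSystem

/-- The curvature of the plane curve that generates a helicoidal rotator of pitch `h`, in terms of
the components `x`, `y` of the position vector along the unit tangent and along its quarter turn. -/
noncomputable def rotatorCurvature (h x y : ℝ) : ℝ :=
  ((2 * x + y) * (x ^ 2 + h ^ 2 * (1 + y ^ 2)) - y * (1 + x ^ 2 + y ^ 2)) /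
    ((1 + x ^ 2 + y ^ 2) * (x ^ 2 + y ^ 2 + h ^ 2))

/-- The tangential and normal components of the position vector of a plane curve whose curvature is
`rotatorCurvature`. -/
structure IsTangentialSystem (h : ℝ) (τ μ : ℝ → ℝ) : Prop where
  pitch_pos : 0 < h
  deriv_fst : ∀ s, HasDerivAt τ (1 + rotatorCurvature h (τ s) (μ s) * μ s) s
  deriv_snd : ∀ s, HasDerivAt μ (-(rotatorCurvature h (τ s) (μ s) * τ s)) s

/-- Half the rate of the linear lower bound of `τ'`. -/
noncomputable def growthRate (h x y : ℝ) : ℝ :=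
  y * (x ^ 2 + h ^ 2 * (1 + y ^ 2)) / ((1 + x ^ 2 + y ^ 2) * (x ^ 2 + y ^ 2 + h ^ 2))

variable {h : ℝ}

theorem rotatorCurvature_neg (x y : ℝ) : rotatorCurvature h (-x) (-y) = -rotatorCurvature h x y := by
  unfold rotatorCurvature
  rw [neg_sq, neg_sq, ← neg_div]
  congr 1
  ring

theorem min_mul_le (x y : ℝ) :
    min 1 (h ^ 2) * (1 + x ^ 2 + y ^ 2) ≤ x ^ 2 + h ^ 2 * (1 + y ^ 2) := by
  have h1 : min 1 (h ^ 2) * x ^ 2 ≤ 1 * x ^ 2 :=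
    mul_le_mul_of_nonneg_right (min_le_left _ _) (sq_nonneg x)
  have h2 : min 1 (h ^ 2) * (1 + y ^ 2) ≤ h ^ 2 * (1 + y ^ 2) :=
    mul_le_mul_of_nonneg_right (min_le_right _ _) (by positivity)
  linarith

theorem le_max_mul (x y : ℝ) :
    x ^ 2 + h ^ 2 * (1 + y ^ 2) ≤ max 1 (h ^ 2) * (1 + x ^ 2 + y ^ 2) := by
  have h1 : 1 * x ^ 2 ≤ max 1 (h ^ 2) * x ^ 2 :=
    mul_le_mul_of_nonneg_right (le_max_left _ _) (sq_nonneg x)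
  have h2 : h ^ 2 * (1 + y ^ 2) ≤ max 1 (h ^ 2) * (1 + y ^ 2) :=
    mul_le_mul_of_nonneg_right (le_max_right _ _) (by positivity)
  linarith

/-- The mixed term 2xy of the numerator of ky is exactly 2x times `growthRate`. With φ² = 1 + x² +
y² and W = x² + h²(1 + y²), what remains of 1 + ky is ((x² + h²)φ² + y²W) / (φ²(x² + y² + h²)), and
W ≥ min(1, h²) φ². -/
theorem growthRate_le_deriv (hh : 0 < h) (x y : ℝ) :
    min 1 (h ^ 2) + 2 * x * growthRate h x y ≤ 1 + rotatorCurvature h x y * y := by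
  have hφ : 0 < 1 + x ^ 2 + y ^ 2 := by positivity
  have hG : 0 < x ^ 2 + y ^ 2 + h ^ 2 := by positivity
  have hm := min_mul_le (h := h) x y
  have key : 1 + rotatorCurvature h x y * y - 2 * x * growthRate h x y - min 1 (h ^ 2) =
      ((x ^ 2 + h ^ 2) * (1 + x ^ 2 + y ^ 2) + y ^ 2 * (x ^ 2 + h ^ 2 * (1 + y ^ 2))
        - min 1 (h ^ 2) * (1 + x ^ 2 + y ^ 2) * (x ^ 2 + y ^ 2 + h ^ 2)) /
      ((1 + x ^ 2 + y ^ 2) * (x ^ 2 + y ^ 2 + h ^ 2)) := by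
    unfold rotatorCurvature growthRate
    field_simp
    ring
  have h1 : 0 ≤ y ^ 2 * (x ^ 2 + h ^ 2 * (1 + y ^ 2) - min 1 (h ^ 2) * (1 + x ^ 2 + y ^ 2)) :=
    mul_nonneg (sq_nonneg y) (by linarith)
  have h2 : 0 ≤ (1 - min 1 (h ^ 2)) * ((x ^ 2 + h ^ 2) * (1 + x ^ 2 + y ^ 2)) :=
    mul_nonneg (by linarith [min_le_left 1 (h ^ 2)]) (by positivity)
  have : 0 ≤ 1 + rotatorCurvature h x y * y - 2 * x * growthRate h x y - min 1 (h ^ 2) := by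
    rw [key]
    refine div_nonneg ?_ (by positivity)
    linarith
  linarith

/-- Combines 2h|y| ≤ y² + h² with `le_max_mul`. -/
theorem abs_growthRate_le (hh : 0 < h) (x y : ℝ) :
    |growthRate h x y| ≤ max 1 (h ^ 2) / (2 * h) := by
  have hφ : 0 < 1 + x ^ 2 + y ^ 2 := by positivity
  have hG : 0 < x ^ 2 + y ^ 2 + h ^ 2 := by positivity
  have hW : 0 < x ^ 2 + h ^ 2 * (1 + y ^ 2) := by positivity
  unfold growthRate
  rw [abs_div, abs_mul, abs_of_pos hW, abs_of_pos (mul_pos hφ hG),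
    div_le_div_iff₀ (by positivity) (by positivity)]
  have h1 : |y| * (2 * h) ≤ x ^ 2 + y ^ 2 + h ^ 2 := by
    nlinarith [sq_nonneg (|y| - h), sq_abs y, sq_nonneg x]
  calc |y| * (x ^ 2 + h ^ 2 * (1 + y ^ 2)) * (2 * h)
      = (|y| * (2 * h)) * (x ^ 2 + h ^ 2 * (1 + y ^ 2)) := by ring
    _ ≤ (x ^ 2 + y ^ 2 + h ^ 2) * (max 1 (h ^ 2) * (1 + x ^ 2 + y ^ 2)) :=
        mul_le_mul h1 (le_max_mul x y) hW.le hG.le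
    _ = _ := by ring

/-- A function whose derivative is at least `m > 0` tends to `+∞`. -/
theorem tendsto_atTop_of_le_hasDerivAt {f f' : ℝ → ℝ} {a m : ℝ} (hm : 0 < m)
    (hf : ∀ s ∈ Ici a, HasDerivAt f (f' s) s) (hle : ∀ s ∈ Ici a, m ≤ f' s) :
    Tendsto f atTop atTop := by
  have hmono : MonotoneOn (fun s => f s - m * s) (Ici a) := by
    refine monotoneOn_of_hasDerivWithinAt_nonneg (f' := fun s => f' s - m * 1) (convex_Ici a)
      (fun s hs => ?_) (fun s hs => ?_) (fun s hs => ?_)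
    · exact ((hf s hs).continuousAt.sub (by fun_prop)).continuousWithinAt
    · rw [interior_Ici] at hs
      exact ((hf s (Ioi_subset_Ici_self hs)).sub ((hasDerivAt_id s).const_mul m)).hasDerivWithinAt
    · rw [interior_Ici] at hs
      have := hle s (Ioi_subset_Ici_self hs)
      linarith
  have h1 : Tendsto (fun s => (f a - m * a) + m * s) atTop atTop :=
    tendsto_atTop_add_const_left _ _ (tendsto_id.const_mul_atTop hm)
  refine tendsto_atTop_mono' _ ?_ h1
  filter_upwards [eventually_ge_atTop a] with s hs
  have := hmono self_mem_Ici hs hs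
  simp only at this
  linarith

/-- Drives the slope μ/τ downwards. Since 2x + y ≥ x, the leading term is at least x m r², where m =
min(1, h²) and r² = x² + y². For large r² half of it absorbs yh² ≥ -xh², and the denominator r² + h²
is at most 2r². -/
theorem le_rotatorCurvature_mul_add (hh : 0 < h) {x y : ℝ} (hx : 0 < x) (hxy : -x ≤ y)
    (hr : 2 * h ^ 2 ≤ min 1 (h ^ 2) * (x ^ 2 + y ^ 2)) :
    min 1 (h ^ 2) / 4 * x ≤ rotatorCurvature h x y * (x ^ 2 + y ^ 2) + y := by
  have hφ : 0 < 1 + x ^ 2 + y ^ 2 := by positivity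
  have hG : 0 < x ^ 2 + y ^ 2 + h ^ 2 := by positivity
  have hr0 : 0 < x ^ 2 + y ^ 2 := by positivity
  have hm0 : 0 < min 1 (h ^ 2) := by positivity
  have hm1 : min 1 (h ^ 2) ≤ 1 := min_le_left _ _
  have key : rotatorCurvature h x y * (x ^ 2 + y ^ 2) + y =
      ((2 * x + y) * ((x ^ 2 + h ^ 2 * (1 + y ^ 2)) / (1 + x ^ 2 + y ^ 2)) * (x ^ 2 + y ^ 2)
        + y * h ^ 2) / (x ^ 2 + y ^ 2 + h ^ 2) := by
    unfold rotatorCurvature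
    field_simp
    ring
  have hW : min 1 (h ^ 2) ≤ (x ^ 2 + h ^ 2 * (1 + y ^ 2)) / (1 + x ^ 2 + y ^ 2) := by
    rw [le_div_iff₀ hφ]
    exact min_mul_le x y
  have h1 : x * (min 1 (h ^ 2) * (x ^ 2 + y ^ 2)) ≤ (2 * x + y) *
      ((x ^ 2 + h ^ 2 * (1 + y ^ 2)) / (1 + x ^ 2 + y ^ 2) * (x ^ 2 + y ^ 2)) :=
    mul_le_mul (by linarith) (mul_le_mul_of_nonneg_right hW hr0.le) (by positivity) (by linarith)
  have h2 : -x * h ^ 2 ≤ y * h ^ 2 := mul_le_mul_of_nonneg_right hxy (sq_nonneg h)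
  have h3 : x * (2 * h ^ 2) ≤ x * (min 1 (h ^ 2) * (x ^ 2 + y ^ 2)) :=
    mul_le_mul_of_nonneg_left hr hx.le
  have h4 : min 1 (h ^ 2) * (x ^ 2 + y ^ 2) ≤ 1 * (x ^ 2 + y ^ 2) :=
    mul_le_mul_of_nonneg_right hm1 hr0.le
  have h5 : min 1 (h ^ 2) / 4 * x * (x ^ 2 + y ^ 2 + h ^ 2) ≤
      min 1 (h ^ 2) / 4 * x * (2 * (x ^ 2 + y ^ 2)) :=
    mul_le_mul_of_nonneg_left (by linarith) (by positivity)
  rw [key, le_div_iff₀ hG]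
  linarith

namespace IsTangentialSystem

variable {τ μ : ℝ → ℝ}

/-- Traversing the curve backwards turns the tangent around, so both components change sign; the
system is preserved because the curvature is odd. Statements about +∞ thereby carry over to -∞. -/
theorem reverse (H : IsTangentialSystem h τ μ) :
    IsTangentialSystem h (fun s => -τ (-s)) (fun s => -μ (-s)) where
  pitch_pos := H.pitch_pos
  deriv_fst s := by
    have := ((H.deriv_fst (-s)).scomp s (hasDerivAt_neg s)).neg
    rw [rotatorCurvature_neg]
    convert! this using 1
    simp
  deriv_snd s := by
    have := ((H.deriv_snd (-s)).scomp s (hasDerivAt_neg s)).neg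
    rw [rotatorCurvature_neg]
    convert! this using 1
    simp

theorem continuous_fst (H : IsTangentialSystem h τ μ) : Continuous τ :=
  continuous_iff_continuousAt.2 fun s => (H.deriv_fst s).continuousAt

theorem continuous_snd (H : IsTangentialSystem h τ μ) : Continuous μ :=
  continuous_iff_continuousAt.2 fun s => (H.deriv_snd s).continuousAt

theorem hasDerivAt_sq_add_sq (H : IsTangentialSystem h τ μ) (s : ℝ) :
    HasDerivAt (fun s => τ s ^ 2 + μ s ^ 2) (2 * τ s) s := by
  refine (((H.deriv_fst s).fun_pow 2).add ((H.deriv_snd s).fun_pow 2)).congr_deriv ?_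
  push_cast
  ring

/-- If τ were always negative, τ - B r² would be negative too; but for B bounding `growthRate` its
derivative is at least m + 2τ(g - B) ≥ m. -/
theorem exists_nonneg (H : IsTangentialSystem h τ μ) : ∃ s, 0 ≤ τ s := by
  by_contra! hneg
  set B := max 1 (h ^ 2) / (2 * h) with hB
  have hB0 : 0 ≤ B := by have := H.pitch_pos; positivity
  have hlim : Tendsto (fun s => τ s - B * (τ s ^ 2 + μ s ^ 2)) atTop atTop := by
    refine tendsto_atTop_of_le_hasDerivAt (a := 0) (m := min 1 (h ^ 2))
      (by have := H.pitch_pos; positivity)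
      (fun s _ => (H.deriv_fst s).sub ((H.hasDerivAt_sq_add_sq s).const_mul B)) (fun s _ => ?_)
    have h1 := growthRate_le_deriv H.pitch_pos (τ s) (μ s)
    have h2 := (abs_le.1 (abs_growthRate_le H.pitch_pos (τ s) (μ s))).2
    nlinarith [hneg s]
  obtain ⟨s, hs⟩ := (hlim.eventually_ge_atTop 0).exists
  have : 0 ≤ B * (τ s ^ 2 + μ s ^ 2) := by positivity
  linarith [hneg s]

theorem exists_eq_zero (H : IsTangentialSystem h τ μ) : ∃ s, τ s = 0 := by
  obtain ⟨a, ha⟩ := H.exists_nonneg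
  obtain ⟨b, hb⟩ := H.reverse.exists_nonneg
  exact mem_range_of_exists_le_of_exists_ge H.continuous_fst ⟨-b, by linarith⟩ ⟨a, ha⟩

/-- The integrating factor of τ' ≥ m + 2τg. It makes τ positive after any of its zeros. -/
theorem exists_strictMono_factor (H : IsTangentialSystem h τ μ) :
    ∃ P : ℝ → ℝ, StrictMono fun s => τ s * Real.exp (P s) := by
  have hh := H.pitch_pos
  have hc : Continuous fun s => growthRate h (τ s) (μ s) := by
    have h1 := H.continuous_fst
    have h2 := H.continuous_snd
    unfold growthRate
    refine Continuous.div (by fun_prop) (by fun_prop) fun s => ?_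
    positivity
  refine ⟨fun s => -∫ t in (0 : ℝ)..s, 2 * growthRate h (τ t) (μ t), strictMono_of_deriv_pos
    fun s => ?_⟩
  have hP : HasDerivAt (fun s => ∫ t in (0 : ℝ)..s, 2 * growthRate h (τ t) (μ t))
      (2 * growthRate h (τ s) (μ s)) s :=
    intervalIntegral.integral_hasDerivAt_right ((hc.const_mul 2).intervalIntegrable _ _)
      (hc.const_mul 2).stronglyMeasurable.stronglyMeasurableAtFilter
      (hc.const_mul 2).continuousAt
  rw [((H.deriv_fst s).fun_mul hP.fun_neg.exp).deriv]
  have h1 := growthRate_le_deriv hh (τ s) (μ s)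
  have hm : 0 < min 1 (h ^ 2) := by positivity
  have h2 : 0 < 1 + rotatorCurvature h (τ s) (μ s) * μ s
      - 2 * τ s * growthRate h (τ s) (μ s) := by linarith
  have := mul_pos h2 (Real.exp_pos (-∫ t in (0 : ℝ)..s, 2 * growthRate h (τ t) (μ t)))
  linarith

theorem pos_of_lt (H : IsTangentialSystem h τ μ) {s₀ s : ℝ} (h0 : τ s₀ = 0) (hs : s₀ < s) :
    0 < τ s := by
  obtain ⟨P, hP⟩ := H.exists_strictMono_factor
  have := hP hs
  simp only [h0, zero_mul] at this
  exact pos_of_mul_pos_left this (Real.exp_pos _).le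

theorem strictMonoOn_sq_add_sq (H : IsTangentialSystem h τ μ) {s₀ : ℝ} (h0 : τ s₀ = 0) :
    StrictMonoOn (fun s => τ s ^ 2 + μ s ^ 2) (Ici s₀) := by
  refine strictMonoOn_of_deriv_pos (convex_Ici _)
    (fun s _ => (H.hasDerivAt_sq_add_sq s).continuousAt.continuousWithinAt) fun s hs => ?_
  rw [interior_Ici] at hs
  rw [(H.hasDerivAt_sq_add_sq s).deriv]
  linarith [H.pos_of_lt h0 hs]

theorem strictAntiOn_sq_add_sq (H : IsTangentialSystem h τ μ) {s₀ : ℝ} (h0 : τ s₀ = 0) :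
    StrictAntiOn (fun s => τ s ^ 2 + μ s ^ 2) (Iic s₀) := by
  intro a ha b hb hab
  have := H.reverse.strictMonoOn_sq_add_sq (s₀ := -s₀) (by simp [h0]) (a := -b) (b := -a)
    (by simpa using hb) (by simpa using ha) (by linarith)
  simpa using this

theorem sq_add_sq_lt (H : IsTangentialSystem h τ μ) {s₀ s : ℝ} (h0 : τ s₀ = 0) (hs : s ≠ s₀) :
    τ s₀ ^ 2 + μ s₀ ^ 2 < τ s ^ 2 + μ s ^ 2 := by
  rcases hs.lt_or_gt with hs | hs
  · exact H.strictAntiOn_sq_add_sq h0 (mem_Iic.2 hs.le) self_mem_Iic hs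
  · exact H.strictMonoOn_sq_add_sq h0 self_mem_Ici (mem_Ici.2 hs.le) hs

/-- After the zero of τ, the function τ + B r² has derivative at least m + 2τ(g + B) ≥ m. It is
bounded by 1 + (1 + B) r², so r² must diverge. -/
theorem tendsto_sq_add_sq (H : IsTangentialSystem h τ μ) :
    Tendsto (fun s => τ s ^ 2 + μ s ^ 2) atTop atTop := by
  obtain ⟨s₀, h0⟩ := H.exists_eq_zero
  have hh := H.pitch_pos
  set B := max 1 (h ^ 2) / (2 * h) with hB
  have hB0 : 0 ≤ B := by positivity
  have hlim : Tendsto (fun s => τ s + B * (τ s ^ 2 + μ s ^ 2)) atTop atTop := by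
    refine tendsto_atTop_of_le_hasDerivAt (a := s₀) (m := min 1 (h ^ 2)) (by positivity)
      (fun s _ => (H.deriv_fst s).add ((H.hasDerivAt_sq_add_sq s).const_mul B)) (fun s hs => ?_)
    have hτ : 0 ≤ τ s := by
      rcases (mem_Ici.1 hs).eq_or_lt with rfl | hs
      · exact h0.ge
      · exact (H.pos_of_lt h0 hs).le
    have h1 := growthRate_le_deriv hh (τ s) (μ s)
    have h2 := (abs_le.1 (abs_growthRate_le hh (τ s) (μ s))).1
    nlinarith
  have h2 : Tendsto (fun s => (1 + B)⁻¹ * (-1 + (τ s + B * (τ s ^ 2 + μ s ^ 2)))) atTop atTop :=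
    (tendsto_atTop_add_const_left _ _ hlim).const_mul_atTop (by positivity)
  refine tendsto_atTop_mono (fun s => ?_) h2
  rw [inv_mul_le_iff₀ (by positivity)]
  nlinarith [sq_nonneg (τ s - 1), sq_nonneg (μ s)]

theorem hasDerivAt_slope (H : IsTangentialSystem h τ μ) {s : ℝ} (hs : 0 < τ s) :
    HasDerivAt (fun s => μ s / τ s)
      (-((rotatorCurvature h (τ s) (μ s) * (τ s ^ 2 + μ s ^ 2) + μ s) / τ s ^ 2)) s := by
  refine ((H.deriv_snd s).fun_div (H.deriv_fst s) hs.ne').congr_deriv ?_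
  rw [← neg_div]
  congr 1
  ring

/-- The normal component becomes negative and comparable with the distance to the origin. -/
theorem eventually_le_neg (H : IsTangentialSystem h τ μ) : ∀ᶠ s in atTop, 0 < τ s ∧ μ s ≤ -τ s := by
  obtain ⟨s₀, h0⟩ := H.exists_eq_zero
  have hh := H.pitch_pos
  set m := min 1 (h ^ 2) with hm
  have hm0 : 0 < m := by positivity
  obtain ⟨S, hS⟩ := ((eventually_gt_atTop s₀).and (H.tendsto_sq_add_sq.eventually_ge_atTop
    (2 * h ^ 2 / m))).exists_forall_of_atTop
  have hτ : ∀ s ≥ S, 0 < τ s := fun s hs => H.pos_of_lt h0 (hS s hs).1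
  have hr : ∀ s ≥ S, 2 * h ^ 2 ≤ m * (τ s ^ 2 + μ s ^ 2) := fun s hs => by
    have := (div_le_iff₀ hm0).1 (hS s hs).2
    linarith
  have hex : ∃ s₁ ≥ S, μ s₁ ≤ -τ s₁ := by
    -- As long as the slope stays above -1, it decreases at least as fast as (m/8) log r² increases;
    -- the latter is unbounded, so the slope must reach -1.
    by_contra! hc
    have hder : ∀ s ≥ S, HasDerivAt (fun s => μ s / τ s + m / 8 * Real.log (τ s ^ 2 + μ s ^ 2))
        (-((rotatorCurvature h (τ s) (μ s) * (τ s ^ 2 + μ s ^ 2) + μ s) / τ s ^ 2)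
          + m / 8 * (2 * τ s / (τ s ^ 2 + μ s ^ 2))) s := fun s hs => by
      have := hτ s hs
      exact (H.hasDerivAt_slope this).add
        (((H.hasDerivAt_sq_add_sq s).log (by positivity)).const_mul _)
    have hanti : AntitoneOn (fun s => μ s / τ s + m / 8 * Real.log (τ s ^ 2 + μ s ^ 2)) (Ici S) := by
      refine antitoneOn_of_hasDerivWithinAt_nonpos (convex_Ici S)
        (fun s hs => (hder s hs).continuousAt.continuousWithinAt)
        (fun s hs => (hder s (interior_subset hs)).hasDerivWithinAt) fun s hs => ?_
      have hs := interior_subset hs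
      have hp := hτ s hs
      have hb := le_rotatorCurvature_mul_add hh hp (hc s hs).le (hr s hs)
      have h1 : m / 8 * (2 * τ s / (τ s ^ 2 + μ s ^ 2)) ≤ m / 8 * (2 * τ s / τ s ^ 2) := by
        gcongr
        exact le_add_of_nonneg_right (sq_nonneg _)
      have h2 : m / 4 * τ s / τ s ^ 2 ≤
          (rotatorCurvature h (τ s) (μ s) * (τ s ^ 2 + μ s ^ 2) + μ s) / τ s ^ 2 :=
        div_le_div_of_nonneg_right hb (sq_nonneg _)
      have h3 : m / 8 * (2 * τ s / τ s ^ 2) = m / 4 * τ s / τ s ^ 2 := by ring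
      linarith
    have hlog : Tendsto (fun s => m / 8 * Real.log (τ s ^ 2 + μ s ^ 2)) atTop atTop :=
      (Real.tendsto_log_atTop.comp H.tendsto_sq_add_sq).const_mul_atTop (by positivity)
    obtain ⟨s, hs1, hs2⟩ := ((hlog.eventually_gt_atTop
      (μ S / τ S + m / 8 * Real.log (τ S ^ 2 + μ S ^ 2) + 1)).and (eventually_ge_atTop S)).exists
    have h1 := hanti self_mem_Ici hs2 hs2
    have h2 : -1 < μ s / τ s := by
      rw [lt_div_iff₀ (hτ s hs2)]
      linarith [hc s hs2]
    simp only at h1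
    linarith
  obtain ⟨s₁, hs₁, hle⟩ := hex
  filter_upwards [eventually_ge_atTop s₁] with s hs
  have hder : ∀ x ≥ s₁, HasDerivAt (fun s => μ s / τ s)
      (-((rotatorCurvature h (τ x) (μ x) * (τ x ^ 2 + μ x ^ 2) + μ x) / τ x ^ 2)) x :=
    fun x hx => H.hasDerivAt_slope (hτ x (hs₁.trans hx))
  -- The value -1 is a barrier: whenever the slope equals -1, its derivative is strictly negative.
  have hfence : μ s / τ s ≤ -1 := by
    refine image_le_of_deriv_right_lt_deriv_boundary (B := fun _ => -1) (B' := fun _ => 0)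
      (fun x hx => (hder x hx.1).continuousAt.continuousWithinAt)
      (fun x hx => (hder x hx.1).hasDerivWithinAt) ?_ (fun x => hasDerivAt_const _ _)
      (fun x hx heq => ?_) (right_mem_Icc.2 hs)
    · rw [div_le_iff₀ (hτ s₁ hs₁)]
      linarith
    · have hp := hτ x (hs₁.trans hx.1)
      rw [div_eq_iff hp.ne'] at heq
      have hb := le_rotatorCurvature_mul_add hh hp (by linarith) (hr x (hs₁.trans hx.1))
      have : 0 < (rotatorCurvature h (τ x) (μ x) * (τ x ^ 2 + μ x ^ 2) + μ x) / τ x ^ 2 :=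
        div_pos (lt_of_lt_of_le (by positivity) hb) (by positivity)
      linarith
  have hp := hτ s (hs₁.trans hs)
  rw [div_le_iff₀ hp] at hfence
  exact ⟨hp, by linarith⟩

end IsTangentialSystem

end TangentialSystem

/-! ### Moving frame of the plane projection and derivatives of the helicoidal surface. -/

section Jets

/-- The unit tangent of the plane projection of `σ`. -/
noncomputable def planeTangent (σ : ℝ → ℂ × ℝ) : ℝ → ℂ := deriv fun x => (σ x).1

/-- The position vector of the plane projection in the frame of tangent and normal: its real and
imaginary part are the tangential and the normal component. -/
noncomputable def framePosition (σ : ℝ → ℂ × ℝ) (s : ℝ) : ℂ :=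
  (σ s).1 * (starRingEnd ℂ) (planeTangent σ s)

/-- The curvature of the plane projection of `σ`. -/
noncomputable def planeCurvature (σ : ℝ → ℂ × ℝ) (s : ℝ) : ℝ :=
  (deriv (planeTangent σ) s * (starRingEnd ℂ) (planeTangent σ s)).im

/-- Rotations are isometries. This allows every inner product to be computed in the frame of the
rotated tangent, where the second parameter v drops out. -/
theorem re_mul_add_im_mul {w : ℂ} (hw : w.re ^ 2 + w.im ^ 2 = 1) (x y : ℂ) :
    (x * w).re * (y * w).re + (x * w).im * (y * w).im = x.re * y.re + x.im * y.im := by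
  simp only [Complex.mul_re, Complex.mul_im]
  linear_combination (x.re * y.re + x.im * y.im) * hw

theorem lorentz_mul {w : ℂ} (hw : w.re ^ 2 + w.im ^ 2 = 1) (x y : ℂ) (a b : ℝ) :
    lorentz (x * w, a) (y * w, b) = x.re * y.re + x.im * y.im - a * b := by
  simp only [lorentz, re_mul_add_im_mul hw]

theorem exp_mul_I_re_sq_add (v : ℝ) :
    (Complex.exp (v * Complex.I)).re ^ 2 + (Complex.exp (v * Complex.I)).im ^ 2 = 1 := by
  rw [Complex.exp_ofReal_mul_I_re, Complex.exp_ofReal_mul_I_im, Real.cos_sq_add_sin_sq]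

theorem hasDerivAt_exp_mul_I (z : ℂ) (v : ℝ) :
    HasDerivAt (fun t : ℝ => Complex.exp (t * Complex.I) * z)
      (Complex.I * (Complex.exp (v * Complex.I) * z)) v := by
  have h2 : HasDerivAt (fun t : ℝ => (t : ℂ) * Complex.I) (1 * Complex.I) v :=
    (HasDerivAt.ofReal_comp (hasDerivAt_id v)).mul_const _
  refine (h2.cexp.mul_const z).congr_deriv ?_
  ring

namespace IsGeneratingCurve

variable {σ : ℝ → ℂ × ℝ}

theorem contDiff_plane (hσ : IsGeneratingCurve σ) : ContDiff ℝ ∞ fun x => (σ x).1 :=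
  hσ.smooth.fst

theorem contDiff_height (hσ : IsGeneratingCurve σ) : ContDiff ℝ ∞ fun x => (σ x).2 :=
  hσ.smooth.snd

theorem contDiff_tangent (hσ : IsGeneratingCurve σ) : ContDiff ℝ ∞ (planeTangent σ) :=
  (contDiff_infty_iff_deriv.1 hσ.contDiff_plane).2

theorem contDiff_deriv_height (hσ : IsGeneratingCurve σ) :
    ContDiff ℝ ∞ (deriv fun x => (σ x).2) :=
  (contDiff_infty_iff_deriv.1 hσ.contDiff_height).2

theorem hasDerivAt_plane (hσ : IsGeneratingCurve σ) (s : ℝ) :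
    HasDerivAt (fun x => (σ x).1) (planeTangent σ s) s :=
  (hσ.contDiff_plane.differentiable (by simp) s).hasDerivAt

theorem hasDerivAt_height (hσ : IsGeneratingCurve σ) (s : ℝ) :
    HasDerivAt (fun x => (σ x).2) (deriv (fun x => (σ x).2) s) s :=
  (hσ.contDiff_height.differentiable (by simp) s).hasDerivAt

theorem hasDerivAt_tangent (hσ : IsGeneratingCurve σ) (s : ℝ) :
    HasDerivAt (planeTangent σ) (deriv (planeTangent σ) s) s :=
  (hσ.contDiff_tangent.differentiable (by simp) s).hasDerivAt

theorem hasDerivAt_deriv_height (hσ : IsGeneratingCurve σ) (s : ℝ) :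
    HasDerivAt (deriv fun x => (σ x).2) (deriv (deriv fun x => (σ x).2) s) s :=
  (hσ.contDiff_deriv_height.differentiable (by simp) s).hasDerivAt

theorem tangent_sq (hσ : IsGeneratingCurve σ) (s : ℝ) :
    (planeTangent σ s).re ^ 2 + (planeTangent σ s).im ^ 2 = 1 := by
  have h1 : ‖planeTangent σ s‖ = 1 := hσ.arcLength s
  have h2 := Complex.sq_norm (planeTangent σ s)
  rw [h1, Complex.normSq_apply] at h2
  linarith

theorem tangent_mul_conj (hσ : IsGeneratingCurve σ) (s : ℝ) :
    (starRingEnd ℂ) (planeTangent σ s) * planeTangent σ s = 1 := by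
  have h2 := hσ.tangent_sq s
  apply Complex.ext
  · simp only [Complex.mul_re, Complex.conj_re, Complex.conj_im, Complex.one_re]
    linarith
  · simp only [Complex.mul_im, Complex.conj_re, Complex.conj_im, Complex.one_im]
    ring

theorem framePosition_mul (hσ : IsGeneratingCurve σ) (s : ℝ) :
    framePosition σ s * planeTangent σ s = (σ s).1 := by
  rw [framePosition, mul_assoc, hσ.tangent_mul_conj, mul_one]

theorem deriv_tangent_re (hσ : IsGeneratingCurve σ) (s : ℝ) :
    (deriv (planeTangent σ) s * (starRingEnd ℂ) (planeTangent σ s)).re = 0 := by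
  have h1 := (hσ.hasDerivAt_tangent s)
  have hre : HasDerivAt (fun x => (planeTangent σ x).re) (deriv (planeTangent σ) s).re s :=
    Complex.reCLM.hasFDerivAt.comp_hasDerivAt s h1
  have him : HasDerivAt (fun x => (planeTangent σ x).im) (deriv (planeTangent σ) s).im s :=
    Complex.imCLM.hasFDerivAt.comp_hasDerivAt s h1
  have h2 := (hre.fun_pow 2).add (him.fun_pow 2)
  have h3 : HasDerivAt (fun x => (planeTangent σ x).re ^ 2 + (planeTangent σ x).im ^ 2) 0 s :=
    (hasDerivAt_const s (1 : ℝ)).congr_of_eventuallyEq (Eventually.of_forall hσ.tangent_sq)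
  have h4 := h2.unique h3
  push_cast at h4
  simp only [Complex.mul_re, Complex.conj_re, Complex.conj_im]
  linarith

theorem deriv_tangent (hσ : IsGeneratingCurve σ) (s : ℝ) :
    deriv (planeTangent σ) s = (Complex.I * planeCurvature σ s) * planeTangent σ s := by
  have h1 : deriv (planeTangent σ) s * (starRingEnd ℂ) (planeTangent σ s) =
      Complex.I * planeCurvature σ s := by
    apply Complex.ext
    · simpa using hσ.deriv_tangent_re s
    · simp [planeCurvature]
  rw [← h1, mul_assoc, hσ.tangent_mul_conj, mul_one]

theorem hasDerivAt_framePosition (hσ : IsGeneratingCurve σ) (s : ℝ) :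
    HasDerivAt (framePosition σ)
      (1 - Complex.I * planeCurvature σ s * framePosition σ s) s := by
  have h1 : HasDerivAt (fun x => (starRingEnd ℂ) (planeTangent σ x))
      ((starRingEnd ℂ) (deriv (planeTangent σ) s)) s :=
    Complex.conjCLE.toContinuousLinearMap.hasFDerivAt.comp_hasDerivAt s (hσ.hasDerivAt_tangent s)
  refine ((hσ.hasDerivAt_plane s).mul h1).congr_deriv ?_
  rw [hσ.deriv_tangent s, framePosition, map_mul, map_mul, Complex.conj_I, Complex.conj_ofReal,
    mul_comm (planeTangent σ s), hσ.tangent_mul_conj]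
  ring

theorem hasDerivAt_framePosition_re (hσ : IsGeneratingCurve σ) (s : ℝ) :
    HasDerivAt (fun x => (framePosition σ x).re)
      (1 + planeCurvature σ s * (framePosition σ s).im) s := by
  have := Complex.reCLM.hasFDerivAt.comp_hasDerivAt s (hσ.hasDerivAt_framePosition s)
  refine this.congr_deriv ?_
  simp

theorem hasDerivAt_framePosition_im (hσ : IsGeneratingCurve σ) (s : ℝ) :
    HasDerivAt (fun x => (framePosition σ x).im)
      (-(planeCurvature σ s * (framePosition σ s).re)) s := by
  have := Complex.imCLM.hasFDerivAt.comp_hasDerivAt s (hσ.hasDerivAt_framePosition s)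
  refine this.congr_deriv ?_
  simp

theorem height_pos (hσ : IsGeneratingCurve σ) (s : ℝ) : 0 < (σ s).2 := (hσ.mem s).2

theorem height_sq (hσ : IsGeneratingCurve σ) (s : ℝ) :
    (σ s).2 ^ 2 = 1 + (framePosition σ s).re ^ 2 + (framePosition σ s).im ^ 2 := by
  have h1 := (hσ.mem s).1
  have h2 := re_mul_add_im_mul (hσ.tangent_sq s) (framePosition σ s) (framePosition σ s)
  rw [hσ.framePosition_mul] at h2
  simp only [lorentz] at h1
  nlinarith

/-- Differentiation of the hyperboloid equation φ² = 1 + τ² + μ², in which the curvature terms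
cancel. -/
theorem deriv_height_mul (hσ : IsGeneratingCurve σ) (s : ℝ) :
    (σ s).2 * deriv (fun x => (σ x).2) s = (framePosition σ s).re := by
  have h1 := (hσ.hasDerivAt_height s).fun_pow 2
  have h2 := ((hσ.hasDerivAt_framePosition_re s).fun_pow 2).add
    ((hσ.hasDerivAt_framePosition_im s).fun_pow 2) |>.const_add 1
  have h3 := h1.unique (h2.congr_of_eventuallyEq (Eventually.of_forall fun x => by
    simp only [Pi.add_apply]; rw [hσ.height_sq x, add_assoc]))
  push_cast at h3
  linarith

theorem deriv_deriv_height_mul (hσ : IsGeneratingCurve σ) (s : ℝ) :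
    deriv (fun x => (σ x).2) s ^ 2 + (σ s).2 * deriv (deriv fun x => (σ x).2) s =
      1 + planeCurvature σ s * (framePosition σ s).im := by
  have h1 := (hσ.hasDerivAt_height s).fun_mul (hσ.hasDerivAt_deriv_height s)
  have h3 := h1.unique ((hσ.hasDerivAt_framePosition_re s).congr_of_eventuallyEq
    (Eventually.of_forall hσ.deriv_height_mul))
  linarith

variable (h : ℝ)

theorem contDiff_helicoidalSurface (hσ : IsGeneratingCurve σ) :
    ContDiff ℝ ∞ (helicoidalSurface h σ) := by
  have h1 : ContDiff ℝ ∞ fun p : ℝ × ℝ => (σ p.1).1 := hσ.contDiff_plane.comp contDiff_fst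
  have h2 : ContDiff ℝ ∞ fun p : ℝ × ℝ => (σ p.1).2 := hσ.contDiff_height.comp contDiff_fst
  have h3 : ContDiff ℝ ∞ fun p : ℝ × ℝ => Complex.exp (p.2 * Complex.I) :=
    ((Complex.ofRealCLM.contDiff.comp contDiff_snd).mul contDiff_const).cexp
  exact ((h3.mul h1).prodMk h2).prodMk (contDiff_const.mul contDiff_snd)

theorem partialU_helicoidalSurface (hσ : IsGeneratingCurve σ) (p : ℝ × ℝ) :
    partialU (helicoidalSurface h σ) p =
      ((Complex.exp (p.2 * Complex.I) * planeTangent σ p.1, deriv (fun x => (σ x).2) p.1), 0) :=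
  ((((hσ.hasDerivAt_plane p.1).const_mul (Complex.exp (p.2 * Complex.I))).prodMk (hσ.hasDerivAt_height p.1)).prodMk
    (hasDerivAt_const p.1 (h * p.2))).deriv

theorem partialV_helicoidalSurface (p : ℝ × ℝ) :
    partialV (helicoidalSurface h σ) p =
      ((Complex.I * (Complex.exp (p.2 * Complex.I) * (σ p.1).1), 0), h) := by
  have := ((((hasDerivAt_exp_mul_I (σ p.1).1 p.2).prodMk
    (hasDerivAt_const p.2 (σ p.1).2)).prodMk ((hasDerivAt_id p.2).const_mul h))).deriv
  rw [mul_one] at this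
  exact this

theorem partialU_partialU_helicoidalSurface (hσ : IsGeneratingCurve σ) (p : ℝ × ℝ) :
    partialU (partialU (helicoidalSurface h σ)) p =
      ((Complex.exp (p.2 * Complex.I) * deriv (planeTangent σ) p.1,
        deriv (deriv fun x => (σ x).2) p.1), 0) := by
  rw [funext (hσ.partialU_helicoidalSurface h)]
  exact ((((hσ.hasDerivAt_tangent p.1).const_mul (Complex.exp (p.2 * Complex.I))).prodMk
    (hσ.hasDerivAt_deriv_height p.1)).prodMk (hasDerivAt_const p.1 (0 : ℝ))).deriv

theorem partialV_partialU_helicoidalSurface (hσ : IsGeneratingCurve σ) (p : ℝ × ℝ) :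
    partialV (partialU (helicoidalSurface h σ)) p =
      ((Complex.I * (Complex.exp (p.2 * Complex.I) * planeTangent σ p.1), 0), 0) := by
  rw [funext (hσ.partialU_helicoidalSurface h)]
  exact (((hasDerivAt_exp_mul_I (planeTangent σ p.1) p.2).prodMk
    (hasDerivAt_const p.2 (deriv (fun x => (σ x).2) p.1))).prodMk
      (hasDerivAt_const p.2 (0 : ℝ))).deriv

theorem partialV_partialV_helicoidalSurface (p : ℝ × ℝ) :
    partialV (partialV (helicoidalSurface h σ)) p =
      ((-(Complex.exp (p.2 * Complex.I) * (σ p.1).1), 0), 0) := by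
  rw [funext (partialV_helicoidalSurface (σ := σ) h)]
  have := ((((hasDerivAt_exp_mul_I (σ p.1).1 p.2).const_mul Complex.I).prodMk
    (hasDerivAt_const p.2 (0 : ℝ))).prodMk (hasDerivAt_const p.2 h)).deriv
  rw [← mul_assoc, Complex.I_mul_I, neg_one_mul] at this
  exact this

end IsGeneratingCurve

end Jets

/-! ### The rotator equation as a prescribed curvature equation. -/

section MeanCurvature

/-- The tangent of the plane projection rotated by the angle of the second parameter. -/
noncomputable def surfaceTangent (σ : ℝ → ℂ × ℝ) (p : ℝ × ℝ) : ℂ :=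
  Complex.exp (p.2 * Complex.I) * planeTangent σ p.1

variable {σ : ℝ → ℂ × ℝ} (h : ℝ)

namespace IsGeneratingCurve

theorem surfaceTangent_sq (hσ : IsGeneratingCurve σ) (p : ℝ × ℝ) :
    (surfaceTangent σ p).re ^ 2 + (surfaceTangent σ p).im ^ 2 = 1 := by
  have h1 := re_mul_add_im_mul (hσ.tangent_sq p.1) (Complex.exp (p.2 * Complex.I))
    (Complex.exp (p.2 * Complex.I))
  have h2 := exp_mul_I_re_sq_add p.2
  rw [surfaceTangent]
  nlinarith

theorem exp_mul_plane (hσ : IsGeneratingCurve σ) (p : ℝ × ℝ) :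
    Complex.exp (p.2 * Complex.I) * (σ p.1).1 = framePosition σ p.1 * surfaceTangent σ p := by
  rw [surfaceTangent, ← hσ.framePosition_mul p.1]
  ring

theorem coeffE_helicoidalSurface (hσ : IsGeneratingCurve σ) (p : ℝ × ℝ) :
    coeffE (helicoidalSurface h σ) p = 1 - deriv (fun x => (σ x).2) p.1 ^ 2 := by
  rw [coeffE, hσ.partialU_helicoidalSurface, ← surfaceTangent]
  have := lorentz_mul (hσ.surfaceTangent_sq p) 1 1 (deriv (fun x => (σ x).2) p.1)
    (deriv (fun x => (σ x).2) p.1)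
  simp only [one_mul] at this
  simp only [inner4, this]
  simp
  ring

theorem coeffF_helicoidalSurface (hσ : IsGeneratingCurve σ) (p : ℝ × ℝ) :
    coeffF (helicoidalSurface h σ) p = -(framePosition σ p.1).im := by
  rw [coeffF, hσ.partialU_helicoidalSurface, partialV_helicoidalSurface, hσ.exp_mul_plane,
    ← surfaceTangent, ← mul_assoc]
  have := lorentz_mul (hσ.surfaceTangent_sq p) 1 (Complex.I * framePosition σ p.1)
    (deriv (fun x => (σ x).2) p.1) 0
  simp only [one_mul] at this
  simp only [inner4, this]
  simp

theorem coeffG_helicoidalSurface (hσ : IsGeneratingCurve σ) (p : ℝ × ℝ) :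
    coeffG (helicoidalSurface h σ) p =
      (framePosition σ p.1).re ^ 2 + (framePosition σ p.1).im ^ 2 + h ^ 2 := by
  rw [coeffG, partialV_helicoidalSurface, hσ.exp_mul_plane, ← mul_assoc]
  simp only [inner4, lorentz_mul (hσ.surfaceTangent_sq p)]
  simp
  ring

variable (p : ℝ × ℝ) (z : ℂ) (c d : ℝ)

theorem lorentz_helicoidalSurface (hσ : IsGeneratingCurve σ) :
    lorentz (helicoidalSurface h σ p).1 (z * surfaceTangent σ p, c) =
      (framePosition σ p.1).re * z.re + (framePosition σ p.1).im * z.im - (σ p.1).2 * c := by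
  rw [helicoidalSurface, hσ.exp_mul_plane, lorentz_mul (hσ.surfaceTangent_sq p)]

theorem inner4_self (hσ : IsGeneratingCurve σ) :
    inner4 ((z * surfaceTangent σ p, c), d) ((z * surfaceTangent σ p, c), d) =
      z.re ^ 2 + z.im ^ 2 - c ^ 2 + d ^ 2 := by
  simp only [inner4, lorentz_mul (hσ.surfaceTangent_sq p)]
  ring

theorem inner4_partialU (hσ : IsGeneratingCurve σ) :
    inner4 (partialU (helicoidalSurface h σ) p) ((z * surfaceTangent σ p, c), d) =
      z.re - deriv (fun x => (σ x).2) p.1 * c := by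
  rw [hσ.partialU_helicoidalSurface, ← surfaceTangent]
  have := lorentz_mul (hσ.surfaceTangent_sq p) 1 z (deriv (fun x => (σ x).2) p.1) c
  simp only [one_mul] at this
  simp only [inner4, this]
  simp

theorem inner4_partialV (hσ : IsGeneratingCurve σ) :
    inner4 (partialV (helicoidalSurface h σ) p) ((z * surfaceTangent σ p, c), d) =
      (framePosition σ p.1).re * z.im - (framePosition σ p.1).im * z.re + h * d := by
  rw [partialV_helicoidalSurface, hσ.exp_mul_plane, ← mul_assoc]
  simp only [inner4, lorentz_mul (hσ.surfaceTangent_sq p)]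
  simp
  ring

theorem inner4_killing (hσ : IsGeneratingCurve σ) :
    inner4 (killing (helicoidalSurface h σ p)) ((z * surfaceTangent σ p, c), d) =
      (framePosition σ p.1).re * z.im - (framePosition σ p.1).im * z.re := by
  rw [killing, helicoidalSurface, hσ.exp_mul_plane, ← mul_assoc]
  simp only [inner4, lorentz_mul (hσ.surfaceTangent_sq p)]
  simp
  ring

theorem inner4_partialU_partialU (hσ : IsGeneratingCurve σ) :
    inner4 (partialU (partialU (helicoidalSurface h σ)) p) ((z * surfaceTangent σ p, c), d) =
      planeCurvature σ p.1 * z.im - deriv (deriv fun x => (σ x).2) p.1 * c := by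
  rw [hσ.partialU_partialU_helicoidalSurface, hσ.deriv_tangent, mul_left_comm, ← surfaceTangent]
  simp only [inner4, lorentz_mul (hσ.surfaceTangent_sq p)]
  simp

theorem inner4_partialV_partialU (hσ : IsGeneratingCurve σ) :
    inner4 (partialV (partialU (helicoidalSurface h σ)) p) ((z * surfaceTangent σ p, c), d) =
      z.im := by
  rw [hσ.partialV_partialU_helicoidalSurface, ← surfaceTangent]
  simp only [inner4, lorentz_mul (hσ.surfaceTangent_sq p)]
  simp

theorem inner4_partialV_partialV (hσ : IsGeneratingCurve σ) :
    inner4 (partialV (partialV (helicoidalSurface h σ)) p) ((z * surfaceTangent σ p, c), d) =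
      -((framePosition σ p.1).re * z.re + (framePosition σ p.1).im * z.im) := by
  rw [partialV_partialV_helicoidalSurface, hσ.exp_mul_plane, ← neg_mul]
  simp only [inner4, lorentz_mul (hσ.surfaceTangent_sq p)]
  simp
  ring

/-- The area element of a helicoidal surface. -/
theorem coeffE_mul_coeffG_sub (hσ : IsGeneratingCurve σ) :
    coeffE (helicoidalSurface h σ) p * coeffG (helicoidalSurface h σ) p
        - coeffF (helicoidalSurface h σ) p ^ 2 =
      ((framePosition σ p.1).re ^ 2 + h ^ 2 * (1 + (framePosition σ p.1).im ^ 2)) /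
        (1 + (framePosition σ p.1).re ^ 2 + (framePosition σ p.1).im ^ 2) := by
  rw [hσ.coeffE_helicoidalSurface, hσ.coeffF_helicoidalSurface, hσ.coeffG_helicoidalSurface,
    ← hσ.height_sq]
  have h0 := hσ.height_pos p.1
  have h1 := hσ.height_sq p.1
  have h2 : deriv (fun x => (σ x).2) p.1 = (framePosition σ p.1).re / (σ p.1).2 := by
    rw [← hσ.deriv_height_mul p.1]
    field_simp
  rw [h2, eq_div_iff (by positivity)]
  field_simp
  rw [h1]
  ring

/-- Normal vectors of a helicoidal surface are multiples of one explicit vector. -/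
theorem exists_eq_of_normal (hσ : IsGeneratingCurve σ) (hh : 0 < h) {z : ℂ} {c d : ℝ}
    (ht : lorentz (helicoidalSurface h σ p).1 (z * surfaceTangent σ p, c) = 0)
    (hu : inner4 (partialU (helicoidalSurface h σ) p) ((z * surfaceTangent σ p, c), d) = 0)
    (hv : inner4 (partialV (helicoidalSurface h σ) p) ((z * surfaceTangent σ p, c), d) = 0) :
    ∃ b : ℝ, z.re = h * (framePosition σ p.1).re * (framePosition σ p.1).im * b ∧
      z.im = h * (1 + (framePosition σ p.1).im ^ 2) * b ∧
      c = h * (framePosition σ p.1).im * (σ p.1).2 * b ∧ d = -((framePosition σ p.1).re * b) := by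
  rw [hσ.lorentz_helicoidalSurface] at ht
  rw [hσ.inner4_partialU] at hu
  rw [hσ.inner4_partialV] at hv
  have h0 := hσ.height_pos p.1
  have h1 := hσ.height_sq p.1
  have h2 := hσ.deriv_height_mul p.1
  set x := (framePosition σ p.1).re
  set y := (framePosition σ p.1).im
  set φ := (σ p.1).2
  have hy : 0 < 1 + y ^ 2 := by positivity
  have hc : c * (1 + y ^ 2) = y * φ * z.im := by
    linear_combination (-φ) * ht + x * φ * hu + x * c * h2 - c * h1
  have hz : φ * z.re = x * c := by linear_combination φ * hu + c * h2
  have hz' : z.re * (1 + y ^ 2) = x * y * z.im := by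
    have : φ * (z.re * (1 + y ^ 2)) = φ * (x * y * z.im) := by
      linear_combination (1 + y ^ 2) * hz + x * hc
    exact mul_left_cancel₀ h0.ne' this
  obtain ⟨b, hb⟩ : ∃ b, z.im = h * (1 + y ^ 2) * b := ⟨z.im / (h * (1 + y ^ 2)), by field_simp⟩
  have hzre : z.re = h * x * y * b :=
    mul_right_cancel₀ hy.ne' (by rw [hz', hb]; ring)
  refine ⟨b, hzre, hb, mul_right_cancel₀ hy.ne' (by rw [hc, hb]; ring),
    mul_left_cancel₀ hh.ne' ?_⟩
  rw [hb, hzre] at hv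
  linear_combination hv

theorem curvature_equation_iff {k x y : ℝ} (hh : 0 < h) :
    (1 + x ^ 2 + y ^ 2) * (x ^ 2 + y ^ 2 + h ^ 2) * k + y * (1 + y ^ 2) * (1 - h ^ 2) =
      2 * x * (x ^ 2 + h ^ 2 * (1 + y ^ 2)) ↔ k = rotatorCurvature h x y := by
  rw [rotatorCurvature, eq_div_iff (by positivity)]
  constructor <;> intro H <;> linear_combination H

/-- The rotator equation in terms of a multiple of the explicit normal vector. -/
theorem meanCurvature_eq_killing_iff (hσ : IsGeneratingCurve σ) (hh : 0 < h) {z : ℂ} {b : ℝ}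
    (hb : b ≠ 0) (hre : z.re = h * (framePosition σ p.1).re * (framePosition σ p.1).im * b)
    (him : z.im = h * (1 + (framePosition σ p.1).im ^ 2) * b)
    {η : ℝ × ℝ → (ℂ × ℝ) × ℝ} (hη : η p = ((z * surfaceTangent σ p,
      h * (framePosition σ p.1).im * (σ p.1).2 * b), -((framePosition σ p.1).re * b))) :
    meanCurvature (helicoidalSurface h σ) η p = inner4 (killing (helicoidalSurface h σ p)) (η p) ↔
      planeCurvature σ p.1 =
        rotatorCurvature h (framePosition σ p.1).re (framePosition σ p.1).im := by
  rw [meanCurvature, hσ.coeffE_mul_coeffG_sub, hη, hσ.inner4_killing, hσ.inner4_partialU_partialU,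
    hσ.inner4_partialV_partialU, hσ.inner4_partialV_partialV, hσ.coeffE_helicoidalSurface,
    hσ.coeffF_helicoidalSurface, hσ.coeffG_helicoidalSurface, ← curvature_equation_iff h hh]
  have h0 := hσ.height_pos p.1
  have h1 := hσ.height_sq p.1
  have h2 := hσ.deriv_height_mul p.1
  have h3 := hσ.deriv_deriv_height_mul p.1
  rw [hre, him]
  set x := (framePosition σ p.1).re
  set y := (framePosition σ p.1).im
  set φ := (σ p.1).2
  set φ' := deriv (fun x => (σ x).2) p.1
  set φ'' := deriv (deriv fun x => (σ x).2) p.1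
  set k := planeCurvature σ p.1
  rw [div_eq_iff (by positivity), ← h1]
  have hx : φ' = x / φ := by
    rw [← h2]
    field_simp
  -- Both derivatives of the height are eliminated, leaving k, x, y and φ as the only quantities,
  -- related by φ² = 1 + x² + y².
  have hx'' : φ'' = (1 + k * y - (x / φ) ^ 2) / φ := by
    rw [← hx, eq_div_iff h0.ne', ← h3]
    ring
  rw [hx, hx'']
  -- The rotator equation, cleared of its denominator, is the curvature equation times this nonzero
  -- factor.
  have hne : h * b / φ ^ 2 ≠ 0 := by positivity
  have iff_of_sub_eq : ∀ {A B C D : ℝ}, A - B = h * b / φ ^ 2 * (C - D) → (A = B ↔ C = D) := by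
    intro A B C D H
    rw [← sub_eq_zero, H, mul_eq_zero_iff_left hne, sub_eq_zero]
  apply iff_of_sub_eq
  field_simp
  linear_combination (y * (2 * (1 + y ^ 2) - (1 + x ^ 2 + y ^ 2) - (x ^ 2 + y ^ 2 + h ^ 2))) * h1

theorem eq_mul_surfaceTangent (hσ : IsGeneratingCurve σ) (n : (ℂ × ℝ) × ℝ) :
    n = ((n.1.1 * (starRingEnd ℂ) (surfaceTangent σ p) * surfaceTangent σ p, n.1.2), n.2) := by
  have h1 : (starRingEnd ℂ) (surfaceTangent σ p) * surfaceTangent σ p = 1 := by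
    rw [mul_comm, Complex.mul_conj, Complex.normSq_apply]
    have := hσ.surfaceTangent_sq p
    exact_mod_cast (by linarith : (surfaceTangent σ p).re * (surfaceTangent σ p).re +
      (surfaceTangent σ p).im * (surfaceTangent σ p).im = 1)
  rw [mul_assoc, h1, mul_one]

variable {h}

/-- The points with v = 0 suffice. The given normal there is a multiple b of the explicit one, and
unit length excludes b = 0. -/
theorem planeCurvature_of_isRotator (hσ : IsGeneratingCurve σ) (hh : 0 < h)
    (hX : IsRotator (helicoidalSurface h σ)) (s : ℝ) :
    planeCurvature σ s = rotatorCurvature h (framePosition σ s).re (framePosition σ s).im := by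
  obtain ⟨-, η, hη, H⟩ := hX
  have hn := hσ.eq_mul_surfaceTangent (s, 0) (η (s, 0))
  have ht := hη.tangent (s, 0)
  have hu := hη.orthogonalU (s, 0)
  have hv := hη.orthogonalV (s, 0)
  have h1 := hη.unit (s, 0)
  rw [hn] at ht hu hv h1
  obtain ⟨b, hre, him, hc, hd⟩ := hσ.exists_eq_of_normal h (s, 0) hh ht hu hv
  rw [hc, hd] at hn
  rw [hσ.inner4_self, hre, him, hc, hd] at h1
  have hb : b ≠ 0 := by
    rintro rfl
    simp at h1
  exact (hσ.meanCurvature_eq_killing_iff h (s, 0) hh hb hre him hn).1 (H (s, 0))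

theorem isTangentialSystem (hσ : IsGeneratingCurve σ) (hh : 0 < h)
    (hX : IsRotator (helicoidalSurface h σ)) :
    IsTangentialSystem h (fun s => (framePosition σ s).re) (fun s => (framePosition σ s).im) where
  pitch_pos := hh
  deriv_fst s := by
    rw [← hσ.planeCurvature_of_isRotator hh hX]
    exact hσ.hasDerivAt_framePosition_re s
  deriv_snd s := by
    rw [← hσ.planeCurvature_of_isRotator hh hX]
    exact hσ.hasDerivAt_framePosition_im s

theorem isRotator_of_planeCurvature (hσ : IsGeneratingCurve σ) (hh : 0 < h)
    (hk : ∀ s, planeCurvature σ s =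
      rotatorCurvature h (framePosition σ s).re (framePosition σ s).im) :
    IsRotator (helicoidalSurface h σ) := by
  have hz : Continuous (framePosition σ) :=
    continuous_iff_continuousAt.2 fun s => (hσ.hasDerivAt_framePosition s).continuousAt
  have hw : Continuous (surfaceTangent σ) := by
    have := hσ.contDiff_tangent.continuous
    unfold surfaceTangent
    fun_prop
  have hφ : Continuous fun s => (σ s).2 := hσ.contDiff_height.continuous
  -- The squared length of the explicit normal with b = 1 is τ² + h²(1 + μ²), so this factor
  -- normalizes it.
  let b : ℝ → ℝ := fun s =>
    (√((framePosition σ s).re ^ 2 + h ^ 2 * (1 + (framePosition σ s).im ^ 2)))⁻¹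
  have hpos : ∀ s, 0 < (framePosition σ s).re ^ 2 + h ^ 2 * (1 + (framePosition σ s).im ^ 2) :=
    fun s => by positivity
  have hre : Continuous fun s => (framePosition σ s).re := Complex.continuous_re.comp hz
  have him : Continuous fun s => (framePosition σ s).im := Complex.continuous_im.comp hz
  have hb : Continuous b :=
    Continuous.inv₀ (by fun_prop) fun s => (Real.sqrt_pos.2 (hpos s)).ne'
  have hb0 : ∀ s, b s ≠ 0 := fun s => (inv_pos.2 (Real.sqrt_pos.2 (hpos s))).ne'
  have hb2 : ∀ s, b s ^ 2 *
      ((framePosition σ s).re ^ 2 + h ^ 2 * (1 + (framePosition σ s).im ^ 2)) = 1 := fun s => by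
    rw [inv_pow, Real.sq_sqrt (hpos s).le, inv_mul_cancel₀ (hpos s).ne']
  let z : ℝ → ℂ := fun s => ⟨h * (framePosition σ s).re * (framePosition σ s).im * b s,
    h * (1 + (framePosition σ s).im ^ 2) * b s⟩
  have hzc : Continuous z := by
    have : z = fun s => ((h * (framePosition σ s).re * (framePosition σ s).im * b s : ℝ) : ℂ) +
        ((h * (1 + (framePosition σ s).im ^ 2) * b s : ℝ) : ℂ) * Complex.I :=
      funext fun s => Complex.mk_eq_add_mul_I _ _
    rw [this]
    exact (Complex.continuous_ofReal.comp (by fun_prop)).add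
      ((Complex.continuous_ofReal.comp (by fun_prop)).mul continuous_const)
  refine ⟨⟨hσ.contDiff_helicoidalSurface h, fun p => ?_, fun p => ?_⟩,
    fun p => ((z p.1 * surfaceTangent σ p, h * (framePosition σ p.1).im * (σ p.1).2 * b p.1),
      -((framePosition σ p.1).re * b p.1)), ⟨?_, fun p => ?_, fun p => ?_, fun p => ?_, fun p => ?_⟩,
    fun p => ?_⟩
  · have h1 := hσ.height_sq p.1
    have h2 := re_mul_add_im_mul (hσ.surfaceTangent_sq p) (framePosition σ p.1)
      (framePosition σ p.1)
    refine ⟨?_, hσ.height_pos p.1⟩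
    simp only [lorentz, helicoidalSurface, hσ.exp_mul_plane]
    linarith
  · rw [hσ.coeffE_mul_coeffG_sub]
    positivity
  · exact (((hzc.comp continuous_fst).mul hw).prodMk
      ((((continuous_const.mul him).mul hφ).mul hb).comp continuous_fst)).prodMk
      ((hre.mul hb).neg.comp continuous_fst)
  · rw [hσ.lorentz_helicoidalSurface]
    linear_combination (-h * (framePosition σ p.1).im * b p.1) * hσ.height_sq p.1
  · rw [hσ.inner4_self]
    linear_combination hb2 p.1 -
      (h ^ 2 * (framePosition σ p.1).im ^ 2 * b p.1 ^ 2) * hσ.height_sq p.1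
  · rw [hσ.inner4_partialU]
    linear_combination (-h * (framePosition σ p.1).im * b p.1) * hσ.deriv_height_mul p.1
  · rw [hσ.inner4_partialV]
    ring
  · exact (hσ.meanCurvature_eq_killing_iff h p hh (hb0 p.1) (z := z p.1) rfl rfl rfl).2 (hk p.1)

end IsGeneratingCurve

end MeanCurvature

/-! ### Construction of the one-parameter family. -/

section Existence

variable {h : ℝ}

/-- Boundedness of the curvature is what makes the flow global. It follows from 2h|x|, 2h|y| ≤ x² +
y² + h². -/
theorem abs_rotatorCurvature_le (hh : 0 < h) (x y : ℝ) :
    |rotatorCurvature h x y| ≤ (3 * max 1 (h ^ 2) + 1) / (2 * h) := by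
  have hφ : 0 < 1 + x ^ 2 + y ^ 2 := by positivity
  have hG : 0 < x ^ 2 + y ^ 2 + h ^ 2 := by positivity
  have hW : 0 ≤ x ^ 2 + h ^ 2 * (1 + y ^ 2) := by positivity
  have hx : |x| * (2 * h) ≤ x ^ 2 + y ^ 2 + h ^ 2 := by
    nlinarith [sq_nonneg (|x| - h), sq_abs x, sq_nonneg y]
  have hy : |y| * (2 * h) ≤ x ^ 2 + y ^ 2 + h ^ 2 := by
    nlinarith [sq_nonneg (|y| - h), sq_abs y, sq_nonneg x]
  have hxy : |2 * x + y| * (2 * h) ≤ 3 * (x ^ 2 + y ^ 2 + h ^ 2) := by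
    have : |2 * x + y| ≤ 2 * |x| + |y| := by
      simpa [abs_mul] using abs_add_le (2 * x) y
    nlinarith
  rw [rotatorCurvature, abs_div, abs_of_pos (mul_pos hφ hG),
    div_le_div_iff₀ (by positivity) (by positivity)]
  calc _ ≤ (|2 * x + y| * (x ^ 2 + h ^ 2 * (1 + y ^ 2)) + |y| * (1 + x ^ 2 + y ^ 2)) * (2 * h) := by
        gcongr
        refine (abs_sub _ _).trans ?_
        rw [abs_mul, abs_mul, abs_of_nonneg hW, abs_of_pos hφ]
    _ = |2 * x + y| * (2 * h) * (x ^ 2 + h ^ 2 * (1 + y ^ 2))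
        + |y| * (2 * h) * (1 + x ^ 2 + y ^ 2) := by ring
    _ ≤ 3 * (x ^ 2 + y ^ 2 + h ^ 2) * (max 1 (h ^ 2) * (1 + x ^ 2 + y ^ 2))
        + (x ^ 2 + y ^ 2 + h ^ 2) * (1 + x ^ 2 + y ^ 2) :=
        add_le_add (mul_le_mul hxy (le_max_mul x y) hW (by positivity))
          (mul_le_mul_of_nonneg_right hy hφ.le)
    _ = _ := by ring

/-- The vector field whose integral curves are the plane curves, with their tangent angle, of
curvature `rotatorCurvature`. -/
noncomputable def rotatorField (h : ℝ) (p : ℂ × ℝ) : ℂ × ℝ :=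
  (Complex.exp (p.2 * Complex.I), rotatorCurvature h
    (p.1 * (starRingEnd ℂ) (Complex.exp (p.2 * Complex.I))).re
    (p.1 * (starRingEnd ℂ) (Complex.exp (p.2 * Complex.I))).im)

theorem contDiff_rotatorField (hh : 0 < h) : ContDiff ℝ ∞ (rotatorField h) := by
  have he : ContDiff ℝ ∞ fun p : ℂ × ℝ => Complex.exp (p.2 * Complex.I) :=
    ((Complex.ofRealCLM.contDiff.comp contDiff_snd).mul contDiff_const).cexp
  have hz : ContDiff ℝ ∞ fun p : ℂ × ℝ =>
      p.1 * (starRingEnd ℂ) (Complex.exp (p.2 * Complex.I)) :=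
    contDiff_fst.mul (Complex.conjCLE.contDiff.comp he)
  have hre := Complex.reCLM.contDiff.comp hz
  have him := Complex.imCLM.contDiff.comp hz
  refine he.prodMk ?_
  unfold rotatorCurvature
  simp only [Function.comp_def, Complex.reCLM_apply, Complex.imCLM_apply] at hre him
  refine ContDiff.div (by fun_prop) (by fun_prop) fun p => ?_
  positivity

theorem norm_rotatorField_le (hh : 0 < h) (p : ℂ × ℝ) :
    ‖rotatorField h p‖ ≤ max 1 ((3 * max 1 (h ^ 2) + 1) / (2 * h)) := by
  rw [rotatorField, Prod.norm_def, Complex.norm_exp_ofReal_mul_I]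
  exact max_le_max le_rfl (abs_rotatorCurvature_le hh _ _)

theorem hypDist_axisPoint (p : ℂ × ℝ) : hypDist axisPoint p = Real.arcosh p.2 := by
  simp [hypDist, lorentz, axisPoint]

/-- The generating curve over a plane curve. -/
noncomputable def liftCurve (α : ℝ → ℂ) (s : ℝ) : ℂ × ℝ :=
  (α s, √(1 + (α s).re ^ 2 + (α s).im ^ 2))

theorem isGeneratingCurve_liftCurve {α : ℝ → ℂ} {Θ : ℝ → ℝ} (hα : ContDiff ℝ ∞ α)
    (hd : ∀ s, HasDerivAt α (Complex.exp (Θ s * Complex.I)) s) :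
    IsGeneratingCurve (liftCurve α) := by
  have hre : ContDiff ℝ ∞ fun s => (α s).re := Complex.reCLM.contDiff.comp hα
  have him : ContDiff ℝ ∞ fun s => (α s).im := Complex.imCLM.contDiff.comp hα
  refine ⟨hα.prodMk (ContDiff.sqrt (by fun_prop) fun s => by positivity), fun s => ⟨?_, ?_⟩,
    fun s => ?_⟩
  · simp only [lorentz, liftCurve]
    rw [Real.mul_self_sqrt (by positivity)]
    ring
  · exact Real.sqrt_pos.2 (by positivity)
  · exact (congrArg norm (hd s).deriv).trans (Complex.norm_exp_ofReal_mul_I _)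

theorem planeTangent_liftCurve {α : ℝ → ℂ} {Θ : ℝ → ℝ}
    (hd : ∀ s, HasDerivAt α (Complex.exp (Θ s * Complex.I)) s) :
    planeTangent (liftCurve α) = fun s => Complex.exp (Θ s * Complex.I) :=
  funext fun s => (hd s).deriv

theorem planeCurvature_liftCurve {α : ℝ → ℂ} {Θ : ℝ → ℝ} {k : ℝ} {s : ℝ}
    (hd : ∀ s, HasDerivAt α (Complex.exp (Θ s * Complex.I)) s) (hΘ : HasDerivAt Θ k s) :
    planeCurvature (liftCurve α) s = k := by
  have h1 : HasDerivAt (fun s => Complex.exp (Θ s * Complex.I))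
      (Complex.exp (Θ s * Complex.I) * (k * Complex.I)) s :=
    ((hΘ.ofReal_comp).mul_const Complex.I).cexp
  rw [planeCurvature, planeTangent_liftCurve hd, h1.deriv, mul_right_comm, Complex.mul_conj,
    Complex.normSq_eq_norm_sq, Complex.norm_exp_ofReal_mul_I]
  simp

theorem exists_family (hh : 0 < h) :
    ∃ σ : ℝ≥0 → ℝ → ℂ × ℝ, Continuous (fun p : ℝ≥0 × ℝ => σ p.1 p.2) ∧
      ∀ c : ℝ≥0, IsGeneratingCurve (σ c) ∧ IsRotator (helicoidalSurface h (σ c)) ∧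
        IsLeast (Set.range fun s => hypDist axisPoint (σ c s)) (c : ℝ) := by
  obtain ⟨Φ, hΦ, hΦ0, hΦd⟩ := exists_continuous_flow
    (L := ⟨max 1 ((3 * max 1 (h ^ 2) + 1) / (2 * h)), by positivity⟩) (norm_rotatorField_le hh)
    (lipschitzOnWith_closedBall_of_contDiff ((contDiff_rotatorField hh).of_le (by simp)))
  -- The initial tangent 1 is perpendicular to the initial position i sinh c, so τ vanishes at
  -- parameter 0, the closest point. Its height is cosh c, hence its distance to the axis point is
  -- c.
  let x₀ : ℝ≥0 → ℂ × ℝ := fun c => ((Real.sinh c : ℂ) * Complex.I, 0)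
  have hx₀ : Continuous x₀ := by fun_prop
  let α : ℝ≥0 → ℝ → ℂ := fun c s => (Φ (x₀ c, s)).1
  let Θ : ℝ≥0 → ℝ → ℝ := fun c s => (Φ (x₀ c, s)).2
  have hα : ∀ c s, HasDerivAt (α c) (Complex.exp (Θ c s * Complex.I)) s := fun c s =>
    (ContinuousLinearMap.fst ℝ ℂ ℝ).hasFDerivAt.comp_hasDerivAt s (hΦd (x₀ c) s)
  have hΘ : ∀ c s, HasDerivAt (Θ c) (rotatorField h (Φ (x₀ c, s))).2 s := fun c s =>
    (ContinuousLinearMap.snd ℝ ℂ ℝ).hasFDerivAt.comp_hasDerivAt s (hΦd (x₀ c) s)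
  have hsm : ∀ c, ContDiff ℝ ∞ (α c) := fun c =>
    (contDiff_of_hasDerivAt_comp (contDiff_rotatorField hh) (hΦd (x₀ c))).fst
  refine ⟨fun c => liftCurve (α c), ?_, fun c => ?_⟩
  · have h1 : Continuous fun p : ℝ≥0 × ℝ => α p.1 p.2 := by
      have : Continuous fun p : ℝ≥0 × ℝ => Φ (x₀ p.1, p.2) := by fun_prop
      exact this.fst
    unfold liftCurve
    exact h1.prodMk (by fun_prop)
  have hgen := isGeneratingCurve_liftCurve (hsm c) (hα c)
  have hrot : IsRotator (helicoidalSurface h (liftCurve (α c))) := by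
    refine hgen.isRotator_of_planeCurvature hh fun s => ?_
    rw [planeCurvature_liftCurve (hα c) (hΘ c s), framePosition, planeTangent_liftCurve (hα c)]
    rfl
  refine ⟨hgen, hrot, ?_⟩
  have hsys := hgen.isTangentialSystem hh hrot
  have h0 : (framePosition (liftCurve (α c)) 0).re = 0 := by
    rw [framePosition, planeTangent_liftCurve (hα c)]
    simp [liftCurve, α, Θ, hΦ0, x₀]
  have hheight : (liftCurve (α c) 0).2 = Real.cosh c := by
    simp only [liftCurve, α, hΦ0, x₀]
    rw [← Real.sqrt_sq (Real.cosh_pos _).le, Real.cosh_sq]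
    simp [-Complex.ofReal_sinh, add_comm]
  refine ⟨⟨0, ?_⟩, ?_⟩
  · simp only [hypDist_axisPoint, hheight]
    exact Real.arcosh_cosh c.coe_nonneg
  · rintro _ ⟨s, rfl⟩
    simp only [hypDist_axisPoint]
    rw [← Real.arcosh_cosh c.coe_nonneg, Real.arcosh_le_arcosh (Real.cosh_pos _) (hgen.height_pos s)]
    rw [← hheight]
    refine le_of_sq_le_sq ?_ (hgen.height_pos s).le
    rw [hgen.height_sq, hgen.height_sq]
    rcases eq_or_ne s 0 with rfl | hs
    · exact le_rfl
    · linarith [hsys.sq_add_sq_lt h0 hs]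

end Existence

/-! ### Angle functions about the axis point and about other points. -/

section Spirals

/-- A differentiable curve in the punctured plane has a differentiable angle function. -/
theorem exists_hasDerivAt_angle {γ γ' : ℝ → ℂ} (hγ : ∀ t ∈ Ioi (0 : ℝ), HasDerivAt γ (γ' t) t)
    (hγ' : ContinuousOn γ' (Ioi 0)) (h0 : ∀ t ∈ Ioi (0 : ℝ), γ t ≠ 0) :
    ∃ θ : ℝ → ℝ, ∀ t ∈ Ioi (0 : ℝ), HasDerivAt θ (γ' t / γ t).im t ∧
      γ t = ‖γ t‖ * Complex.exp (θ t * Complex.I) := by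
  have hcont : ContinuousOn (fun t => γ' t / γ t) (Ioi 0) :=
    hγ'.div (fun t ht => (hγ t ht).continuousAt.continuousWithinAt) h0
  -- A logarithm of γ up to a constant. The base point is 1 because γ is only controlled for t > 0
  -- and may start at the origin.
  let L : ℝ → ℂ := fun t => ∫ x in (1 : ℝ)..t, γ' x / γ x
  have hL : ∀ t ∈ Ioi (0 : ℝ), HasDerivAt L (γ' t / γ t) t := fun t ht => by
    refine intervalIntegral.integral_hasDerivAt_right ?_
      (hcont.stronglyMeasurableAtFilter isOpen_Ioi t ht) (hcont.continuousAt (Ioi_mem_nhds ht))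
    refine (hcont.mono fun x hx => ?_).intervalIntegrable
    exact lt_of_lt_of_le (lt_min one_pos ht) hx.1
  have hconst : ∀ t ∈ Ioi (0 : ℝ), γ t * Complex.exp (-L t) = γ 1 := fun t ht => by
    have hd : ∀ x ∈ Ioi (0 : ℝ), HasDerivAt (fun x => γ x * Complex.exp (-L x)) 0 x :=
      fun x hx => by
        refine ((hγ x hx).mul (hL x hx).neg.cexp).congr_deriv ?_
        have := h0 x hx
        simp only [Pi.neg_apply]
        field_simp
        ring
    have := isOpen_Ioi.is_const_of_deriv_eq_zero isPreconnected_Ioi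
      (fun x hx => (hd x hx).differentiableAt.differentiableWithinAt)
      (fun x hx => (hd x hx).deriv) ht (mem_Ioi.2 one_pos)
    simpa [L] using this
  refine ⟨fun t => (γ 1).arg + (L t).im, fun t ht => ⟨?_, ?_⟩⟩
  · exact (Complex.imCLM.hasFDerivAt.comp_hasDerivAt t (hL t ht)).const_add _
  · have h1 : γ t = γ 1 * Complex.exp (L t) := by
      rw [← hconst t ht, mul_assoc, ← Complex.exp_add, neg_add_cancel, Complex.exp_zero, mul_one]
    have h2 : Complex.exp (L t) = Real.exp (L t).re * Complex.exp ((L t).im * Complex.I) := by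
      rw [Complex.ofReal_exp, ← Complex.exp_add, Complex.re_add_im]
    have h3 : ‖γ t‖ = ‖γ 1‖ * Real.exp (L t).re := by
      rw [h1, norm_mul, Complex.norm_exp]
    rw [h3, h1, h2]
    nth_rw 1 [← Complex.norm_mul_exp_arg_mul_I (γ 1)]
    push_cast
    rw [add_mul, Complex.exp_add]
    ring

variable {u : ℂ} {r₀ φ₀ : ℝ}

/-- The radial and angular directions of polar coordinates about the axis point. The case r₀ = 0,
with u arbitrary, provides a frame at the axis point itself. -/
theorem isFrame_polar (hu : u.re ^ 2 + u.im ^ 2 = 1) (hφ₀ : φ₀ ^ 2 = 1 + r₀ ^ 2) :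
    IsFrame (r₀ * u, φ₀) (φ₀ * u, r₀) (Complex.I * u, 0) := by
  constructor
  · simp [lorentz]; linear_combination r₀ * φ₀ * hu
  · simp [lorentz]; ring
  · simp [lorentz]; linear_combination φ₀ ^ 2 * hu + hφ₀
  · simp [lorentz]; linear_combination hu
  · simp [lorentz]; ring
  · rw [Matrix.det_fin_three]
    simp
    have : φ₀ * u.re * u.re * φ₀ + φ₀ * u.im * u.im * φ₀ - r₀ * u.im * (r₀ * u.im)
      - r₀ * u.re * (r₀ * u.re) = 1 := by linear_combination (φ₀ ^ 2 - r₀ ^ 2) * hu + hφ₀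
    linarith

/-- Seen from a point `q` and from the axis point, points of the hyperbolic plane farther away from
the axis point than `q` do not lie in opposite directions. -/
theorem mul_conj_mem_slitPlane (hr₀ : 0 ≤ r₀) (hφ₀ : 0 < φ₀) (hq : φ₀ ^ 2 = 1 + r₀ ^ 2)
    {a b φ : ℝ} (hφ : 0 < φ) (hp : φ ^ 2 = 1 + a ^ 2 + b ^ 2) (hlt : r₀ ^ 2 < a ^ 2 + b ^ 2) :
    (⟨φ₀ * a - r₀ * φ, b⟩ : ℂ) * (starRingEnd ℂ) ⟨a, b⟩ ∈ Complex.slitPlane := by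
  rw [Complex.mem_slitPlane_iff]
  simp only [Complex.mul_re, Complex.mul_im, Complex.conj_re, Complex.conj_im]
  -- The directions from both points have the same component b across the line through them. If b =
  -- 0, then (φ₀a)² - (r₀φ)² = a² - r₀² > 0, so both point the same way; if b ≠ 0, they are parallel
  -- only when equal.
  by_cases hb : b = 0
  · subst hb
    left
    have hsq : (r₀ * φ) ^ 2 < (φ₀ * a) ^ 2 := by nlinarith
    rcases lt_or_ge a 0 with ha | ha
    · have : φ₀ * a - r₀ * φ < 0 := by nlinarith [mul_neg_of_pos_of_neg hφ₀ ha, mul_nonneg hr₀ hφ.le]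
      nlinarith
    · have h1 : r₀ * φ < φ₀ * a := lt_of_pow_lt_pow_left₀ 2 (by positivity) hsq
      have h2 : 0 < a := by
        rcases ha.eq_or_lt with rfl | ha
        · nlinarith
        · exact ha
      nlinarith
  · by_cases h : φ₀ * a - r₀ * φ = a
    · left
      rw [h]
      have : 0 < b ^ 2 := by positivity
      nlinarith [sq_nonneg a]
    · right
      have : (φ₀ * a - r₀ * φ) * -b + b * a = b * (a - (φ₀ * a - r₀ * φ)) := by ring
      rw [this]
      exact mul_ne_zero hb (sub_ne_zero.2 (Ne.symm h))

/-- Transfers the angle about the axis point to q = (r₀u, φ₀). Here z is the position relative to u,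
and w collects the tangential components of γ in the frame at q, so ‖w‖ is the hyperbolic sine of
the distance to q. -/
theorem spiralsAround_of_angle (hu : u.re ^ 2 + u.im ^ 2 = 1) (hr₀ : 0 ≤ r₀) (hφ₀ : 0 < φ₀)
    (hq : φ₀ ^ 2 = 1 + r₀ ^ 2) {γ : ℝ → ℂ × ℝ} (hγ : ∀ t > 0, γ t ∈ hyperbolicPlane)
    (hc : ContinuousOn γ (Ioi 0)) (hlt : ∀ t > 0, r₀ < ‖(γ t).1‖) {θ : ℝ → ℝ}
    (hθc : ContinuousOn θ (Ioi 0))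
    (hθ : ∀ t > 0, (γ t).1 = ‖(γ t).1‖ * Complex.exp (θ t * Complex.I))
    (hlim : Tendsto θ atTop atTop) : SpiralsAround γ (r₀ * u, φ₀) := by
  have huu : (starRingEnd ℂ) u * u = 1 := by
    rw [mul_comm, Complex.mul_conj, Complex.normSq_apply]
    exact_mod_cast (by linarith : u.re * u.re + u.im * u.im = 1)
  have hnu : ‖u‖ = 1 := by
    have := Complex.sq_norm u
    rw [Complex.normSq_apply] at this
    nlinarith [norm_nonneg u]
  let z : ℝ → ℂ := fun t => (γ t).1 * (starRingEnd ℂ) u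
  let w : ℝ → ℂ := fun t => ⟨φ₀ * (z t).re - r₀ * (γ t).2, (z t).im⟩
  have hz : ∀ t, z t * u = (γ t).1 := fun t => by
    simp only [z]
    rw [mul_assoc, huu, mul_one]
  have hznorm : ∀ t, ‖z t‖ = ‖(γ t).1‖ := fun t => by
    simp [z, hnu]
  have hsq : ∀ t, (z t).re ^ 2 + (z t).im ^ 2 = ‖z t‖ ^ 2 := fun t => by
    rw [Complex.sq_norm, Complex.normSq_apply]
    ring
  have hp : ∀ t > 0, (γ t).2 ^ 2 = 1 + (z t).re ^ 2 + (z t).im ^ 2 := fun t ht => by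
    have h1 := (hγ t ht).1
    have h2 := Complex.sq_norm (γ t).1
    rw [Complex.normSq_apply, ← hznorm, ← hsq] at h2
    simp only [lorentz] at h1
    linarith
  have hslit : ∀ t > 0, w t * (starRingEnd ℂ) (z t) ∈ Complex.slitPlane := fun t ht =>
    mul_conj_mem_slitPlane hr₀ hφ₀ hq (hγ t ht).2 (hp t ht) (by
      rw [hsq, hznorm]
      exact pow_lt_pow_left₀ (hlt t ht) hr₀ two_ne_zero)
  have hzpos : ∀ t > 0, 0 < ‖z t‖ := fun t ht => by
    rw [hznorm]
    exact hr₀.trans_lt (hlt t ht)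
  have hw0 : ∀ t > 0, w t ≠ 0 := fun t ht h => by
    have := Complex.slitPlane_ne_zero (hslit t ht)
    simp [h] at this
  have hc1 : ContinuousOn (fun t => (γ t).1) (Ioi 0) := continuous_fst.comp_continuousOn hc
  have hc2 : ContinuousOn (fun t => (γ t).2) (Ioi 0) := continuous_snd.comp_continuousOn hc
  have hzc : ContinuousOn z (Ioi 0) := hc1.mul continuousOn_const
  have hwc : ContinuousOn w (Ioi 0) := by
    have : w = fun t => ((φ₀ * (z t).re - r₀ * (γ t).2 : ℝ) : ℂ) + ((z t).im : ℂ) * Complex.I :=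
      funext fun t => Complex.mk_eq_add_mul_I _ _
    rw [this]
    have h1 := Complex.continuous_re.comp_continuousOn hzc
    have h2 := Complex.continuous_im.comp_continuousOn hzc
    exact (Complex.continuous_ofReal.comp_continuousOn
      ((continuousOn_const.mul h1).sub (continuousOn_const.mul hc2))).add
      ((Complex.continuous_ofReal.comp_continuousOn h2).mul continuousOn_const)
  -- The angle from z to w. It is continuous because the product avoids the cut of the argument, and
  -- it is bounded by π, so adding it does not affect divergence.
  let δ : ℝ → ℝ := fun t => (w t * (starRingEnd ℂ) (z t)).arg
  have hδ : ContinuousOn δ (Ioi 0) := fun t ht =>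
    ContinuousAt.comp_continuousWithinAt (f := fun t => w t * (starRingEnd ℂ) (z t))
      (Complex.continuousAt_arg (hslit t ht))
      ((hwc t ht).mul (Complex.continuous_conj.continuousAt.comp_continuousWithinAt (hzc t ht)))
  have hwexp : ∀ t > 0, w t = ‖w t‖ * Complex.exp ((θ t - u.arg + δ t : ℝ) * Complex.I) :=
      fun t ht => by
    have hu' : u = Complex.exp (u.arg * Complex.I) := by
      have := Complex.norm_mul_exp_arg_mul_I u
      rw [hnu] at this
      simpa using this.symm
    have hz' : z t = ‖z t‖ * Complex.exp ((θ t - u.arg : ℝ) * Complex.I) := by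
      have h1 : z t * u = (‖z t‖ * Complex.exp ((θ t - u.arg : ℝ) * Complex.I)) * u := by
        nth_rw 3 [hu']
        rw [hz, mul_assoc, ← Complex.exp_add, hznorm]
        nth_rw 1 [hθ t ht]
        congr 2
        push_cast
        ring
      exact mul_right_cancel₀ (by rw [← norm_ne_zero_iff, hnu]; exact one_ne_zero) h1
    have hzz : (starRingEnd ℂ) (z t) * z t = (‖z t‖ : ℂ) ^ 2 := by
      rw [mul_comm, Complex.mul_conj, Complex.normSq_eq_norm_sq]
      push_cast
      rfl
    have hn : (‖z t‖ : ℂ) ≠ 0 := by exact_mod_cast (hzpos t ht).ne'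
    have h2 := Complex.norm_mul_exp_arg_mul_I (w t * (starRingEnd ℂ) (z t))
    rw [norm_mul, RCLike.norm_conj] at h2
    push_cast at h2
    have h3 : (‖z t‖ : ℂ) ^ 2 * w t = (‖z t‖ : ℂ) ^ 2 *
        (‖w t‖ * Complex.exp ((θ t - u.arg + δ t : ℝ) * Complex.I)) := by
      have h4 : Complex.exp ((θ t - u.arg + δ t : ℝ) * Complex.I) =
          Complex.exp ((θ t - u.arg : ℝ) * Complex.I) * Complex.exp (δ t * Complex.I) := by
        rw [← Complex.exp_add]
        push_cast
        ring_nf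
      rw [← hzz, mul_right_comm, mul_comm ((starRingEnd ℂ) (z t)) (w t), ← h2, h4]
      nth_rw 3 [hz']
      rw [hzz]
      ring
    exact mul_left_cancel₀ (pow_ne_zero 2 hn) h3
  refine ⟨_, _, isFrame_polar hu hq, fun t => Real.arsinh ‖w t‖, fun t => θ t - u.arg + δ t,
    (hθc.sub continuousOn_const).add hδ, fun t ht => ⟨?_, ?_⟩, ?_⟩
  · exact Real.arsinh_pos_iff.2 (norm_pos_iff.2 (hw0 t ht))
  · have hφ := (hγ t ht).2
    have hpt := hp t ht
    have hwsq : ‖w t‖ ^ 2 = (φ₀ * (z t).re - r₀ * (γ t).2) ^ 2 + (z t).im ^ 2 := by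
      rw [Complex.sq_norm, Complex.normSq_apply]
      ring
    have hcosh : Real.cosh (Real.arsinh ‖w t‖) = φ₀ * (γ t).2 - r₀ * (z t).re := by
      have hnonneg : 0 ≤ φ₀ * (γ t).2 - r₀ * (z t).re := by
        have h1 : r₀ ≤ φ₀ := le_of_sq_le_sq (by linarith) hφ₀.le
        have h2 : (z t).re ≤ (γ t).2 := le_of_sq_le_sq (by nlinarith [sq_nonneg (z t).im]) hφ.le
        nlinarith
      rw [Real.cosh_arsinh, ← Real.sqrt_sq hnonneg]
      congr 1
      rw [hwsq]
      linear_combination (-(γ t).2 ^ 2 + (z t).re ^ 2) * hq + (-1) * hpt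
    have hre : ‖w t‖ * Real.cos (θ t - u.arg + δ t) = φ₀ * (z t).re - r₀ * (γ t).2 := by
      have := congrArg Complex.re (hwexp t ht)
      rw [Complex.re_ofReal_mul, Complex.exp_ofReal_mul_I_re] at this
      exact this.symm
    have him : ‖w t‖ * Real.sin (θ t - u.arg + δ t) = (z t).im := by
      have := congrArg Complex.im (hwexp t ht)
      rw [Complex.im_ofReal_mul, Complex.exp_ofReal_mul_I_im] at this
      exact this.symm
    have hzt := hz t
    rw [hcosh, Real.sinh_arsinh, smul_add, smul_smul, smul_smul, hre, him]
    refine Prod.ext ?_ ?_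
    · rw [← hzt]
      apply Complex.ext
      · simp
        linear_combination (-(z t).re * u.re) * hq
      · simp
        linear_combination (-(z t).re * u.im) * hq
    · simp
      linear_combination (-(γ t).2) * hq
  · refine tendsto_atTop_mono (fun t => ?_)
      (tendsto_atTop_add_const_right _ (-u.arg - Real.pi) hlim)
    have := Complex.neg_pi_lt_arg (w t * (starRingEnd ℂ) (z t))
    simp only [δ]
    linarith

end Spirals

/-! ### Properness and spiraling of the two arms. -/

section Arms

variable {σ : ℝ → ℂ × ℝ} {h : ℝ}

/-- A strictly increasing height gives injectivity; a divergent height gives properness, hence a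
closed map, and divergence of the distance arcosh of the height. -/
theorem isUnboundedProperArm_of_height {γ : ℝ → ℂ × ℝ} (hmem : ∀ t, γ t ∈ hyperbolicPlane)
    (hc : Continuous γ) (hmono : StrictMonoOn (fun t => (γ t).2) (Ici 0))
    (hlim : Tendsto (fun t => (γ t).2) atTop atTop) : IsUnboundedProperArm γ := by
  have hcoe : Tendsto (fun t : Ici (0 : ℝ) => (t : ℝ)) (cocompact (Ici (0 : ℝ))) atTop := by
    refine tendsto_atTop.2 fun b => ?_
    have := (isClosed_Ici (a := (0 : ℝ))).isClosedEmbedding_subtypeVal.tendsto_cocompact.eventually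
      (isCompact_Icc (a := (0 : ℝ)) (b := b)).compl_mem_cocompact
    filter_upwards [this] with t ht
    by_contra! hlt
    exact ht ⟨t.2, hlt.le⟩
  refine ⟨fun t _ => hmem t, ?_, ?_⟩
  · have hcont : Continuous fun t : Ici (0 : ℝ) => γ t := hc.comp continuous_subtype_val
    refine IsClosedEmbedding.of_continuous_injective_isClosedMap hcont (fun a b hab => ?_)
      (isProperMap_iff_tendsto_cocompact.2 ⟨hcont, ?_⟩).isClosedMap
    · exact Subtype.ext (hmono.injOn a.2 b.2 (congrArg Prod.snd hab))
    · rw [← Metric.cobounded_eq_cocompact (α := ℂ × ℝ), ← tendsto_norm_atTop_iff_cobounded]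
      refine tendsto_atTop_mono (fun t => ?_) (hlim.comp hcoe)
      exact (le_abs_self _).trans (norm_snd_le (γ t))
  · simp only [hypDist_axisPoint]
    refine tendsto_atTop.2 fun b => ?_
    filter_upwards [hlim.eventually_ge_atTop (Real.cosh b)] with t ht
    rw [← Real.cosh_abs] at ht
    have := (Real.arcosh_le_arcosh (Real.cosh_pos _) (hmem t).2).2 ht
    rw [Real.arcosh_cosh (abs_nonneg b)] at this
    exact (le_abs_self b).trans this

/-- Once μ ≤ -τ, the angle grows at least as fast as ½ log r², whose derivative is τ/r². -/
theorem axisPoint_spiral_angle {τ μ : ℝ → ℝ} (H : IsTangentialSystem h τ μ) {s₀ : ℝ} {θ : ℝ → ℝ}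
    (hθ : ∀ t ∈ Ioi (0 : ℝ),
      HasDerivAt θ (-μ (s₀ + t) / (τ (s₀ + t) ^ 2 + μ (s₀ + t) ^ 2)) t) :
    Tendsto θ atTop atTop := by
  have hshift : Tendsto (fun t => s₀ + t) atTop atTop := tendsto_atTop_add_const_left _ _ tendsto_id
  obtain ⟨S, hS⟩ := ((hshift.eventually H.eventually_le_neg).and
    (eventually_gt_atTop 0)).exists_forall_of_atTop
  let ρ : ℝ → ℝ := fun t => τ (s₀ + t) ^ 2 + μ (s₀ + t) ^ 2
  have hρ : ∀ t ≥ S, HasDerivAt (fun t => 1 / 2 * Real.log (ρ t))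
      (1 / 2 * (2 * τ (s₀ + t) / ρ t)) t := fun t ht => by
    have hτ := (hS t ht).1.1
    exact (((H.hasDerivAt_sq_add_sq (s₀ + t)).comp_const_add s₀ t).log
      (by positivity)).const_mul _
  have hmono : MonotoneOn (fun t => θ t - 1 / 2 * Real.log (ρ t)) (Ici S) := by
    refine monotoneOn_of_hasDerivWithinAt_nonneg (convex_Ici S)
      (fun t ht => ((hθ t (hS t ht).2).sub (hρ t ht)).continuousAt.continuousWithinAt)
      (fun t ht => ((hθ t (hS t (interior_subset ht)).2).sub
        (hρ t (interior_subset ht))).hasDerivWithinAt) fun t ht => ?_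
    have hτ := (hS t (interior_subset ht)).1
    have hpos : 0 < ρ t := by
      have := hτ.1
      positivity
    have : -μ (s₀ + t) / ρ t - 1 / 2 * (2 * τ (s₀ + t) / ρ t) =
        (-μ (s₀ + t) - τ (s₀ + t)) / ρ t := by ring
    change 0 ≤ -μ (s₀ + t) / ρ t - 1 / 2 * (2 * τ (s₀ + t) / ρ t)
    rw [this]
    exact div_nonneg (by linarith [hτ.2]) hpos.le
  have hlog : Tendsto (fun t => (θ S - 1 / 2 * Real.log (ρ S)) + 1 / 2 * Real.log (ρ t))
      atTop atTop :=
    tendsto_atTop_add_const_left _ _ ((Real.tendsto_log_atTop.comp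
      (H.tendsto_sq_add_sq.comp hshift)).const_mul_atTop (by norm_num))
  refine tendsto_atTop_mono' _ ?_ hlog
  filter_upwards [eventually_ge_atTop S] with t ht
  have := hmono self_mem_Ici ht ht
  simp only at this
  linarith

namespace IsGeneratingCurve

theorem norm_plane_sq (hσ : IsGeneratingCurve σ) (s : ℝ) :
    ‖(σ s).1‖ ^ 2 = (framePosition σ s).re ^ 2 + (framePosition σ s).im ^ 2 := by
  have h1 := (hσ.mem s).1
  have h2 := hσ.height_sq s
  rw [Complex.sq_norm, Complex.normSq_apply]
  simp only [lorentz] at h1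
  linarith

theorem height_eq_sqrt (hσ : IsGeneratingCurve σ) (s : ℝ) :
    (σ s).2 = √(1 + ((framePosition σ s).re ^ 2 + (framePosition σ s).im ^ 2)) := by
  rw [← add_assoc, ← hσ.height_sq, Real.sqrt_sq (hσ.height_pos s).le]

theorem deriv_angle (hσ : IsGeneratingCurve σ) (s : ℝ) :
    (planeTangent σ s / (σ s).1).im = -(framePosition σ s).im /
      ((framePosition σ s).re ^ 2 + (framePosition σ s).im ^ 2) := by
  rw [← hσ.norm_plane_sq, Complex.sq_norm, framePosition, Complex.div_im]
  simp only [Complex.mul_im, Complex.conj_re, Complex.conj_im]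
  ring

theorem arm (hσ : IsGeneratingCurve σ)
    (H : IsTangentialSystem h (fun s => (framePosition σ s).re) fun s => (framePosition σ s).im)
    {s₀ : ℝ} (h0 : (framePosition σ s₀).re = 0) :
    IsUnboundedProperArm (fun t => σ (s₀ + t)) ∧ SpiralsAround (fun t => σ (s₀ + t)) axisPoint ∧
      SpiralsAround (fun t => σ (s₀ + t)) (σ s₀) := by
  have hshift : Tendsto (fun t => s₀ + t) atTop atTop := tendsto_atTop_add_const_left _ _ tendsto_id
  have hc : Continuous fun t => σ (s₀ + t) := hσ.smooth.continuous.comp (by fun_prop)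
  have hlt : ∀ t > 0, ‖(σ s₀).1‖ < ‖(σ (s₀ + t)).1‖ := fun t ht => by
    refine lt_of_pow_lt_pow_left₀ 2 (norm_nonneg _) ?_
    rw [hσ.norm_plane_sq, hσ.norm_plane_sq]
    exact H.sq_add_sq_lt h0 (by linarith)
  have hpos : ∀ t > 0, 0 < ‖(σ (s₀ + t)).1‖ := fun t ht => (norm_nonneg _).trans_lt (hlt t ht)
  obtain ⟨θ, hθ⟩ := exists_hasDerivAt_angle (γ := fun t => (σ (s₀ + t)).1)
    (γ' := fun t => planeTangent σ (s₀ + t))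
    (fun t _ => (hσ.hasDerivAt_plane (s₀ + t)).comp_const_add s₀ t)
    (hσ.contDiff_tangent.continuous.comp (by fun_prop)).continuousOn
    (fun t ht => norm_pos_iff.1 (hpos t ht))
  have hθc : ContinuousOn θ (Ioi 0) := fun t ht => (hθ t ht).1.continuousAt.continuousWithinAt
  have hlim : Tendsto θ atTop atTop := by
    refine axisPoint_spiral_angle (s₀ := s₀) H fun t ht => ?_
    rw [← hσ.deriv_angle]
    exact (hθ t ht).1
  refine ⟨isUnboundedProperArm_of_height (fun t => hσ.mem _) hc (fun a ha b hb hab => ?_) ?_,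
    ?_, ?_⟩
  · have := H.strictMonoOn_sq_add_sq h0 (a := s₀ + a) (b := s₀ + b)
      (by simpa using ha) (by simpa using hb) (by linarith)
    simp only [hσ.height_eq_sqrt] at this ⊢
    exact Real.sqrt_lt_sqrt (by positivity) (by linarith)
  · simp only [hσ.height_eq_sqrt]
    exact Real.tendsto_sqrt_atTop.comp
      (tendsto_atTop_add_const_left _ _ (H.tendsto_sq_add_sq.comp hshift))
  · have := spiralsAround_of_angle (u := 1) (r₀ := 0) (φ₀ := 1) (by simp) le_rfl one_pos (by simp)
      (fun t _ => hσ.mem (s₀ + t)) hc.continuousOn hpos hθc (fun t ht => (hθ t ht).2) hlim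
    simpa [axisPoint] using this
  · have hu : (Complex.exp ((σ s₀).1.arg * Complex.I)).re ^ 2 +
        (Complex.exp ((σ s₀).1.arg * Complex.I)).im ^ 2 = 1 := exp_mul_I_re_sq_add _
    have := spiralsAround_of_angle hu (norm_nonneg (σ s₀).1) (hσ.height_pos s₀)
      (by rw [hσ.height_sq, hσ.norm_plane_sq, add_assoc])
      (fun t _ => hσ.mem (s₀ + t)) hc.continuousOn hlt hθc (fun t ht => (hθ t ht).2) hlim
    rwa [Complex.norm_mul_exp_arg_mul_I] at this

theorem reverse (hσ : IsGeneratingCurve σ) : IsGeneratingCurve fun s => σ (-s) where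
  smooth := hσ.smooth.comp contDiff_neg
  mem s := hσ.mem (-s)
  arcLength s := by
    rw [deriv_comp_neg (fun x => (σ x).1), norm_neg]
    exact hσ.arcLength (-s)

theorem framePosition_reverse (s : ℝ) :
    framePosition (fun s => σ (-s)) s = -framePosition σ (-s) := by
  simp only [framePosition, planeTangent]
  rw [deriv_comp_neg (fun x => (σ x).1), map_neg, mul_neg]

theorem hasSpiralingArms (hσ : IsGeneratingCurve σ)
    (H : IsTangentialSystem h (fun s => (framePosition σ s).re) fun s => (framePosition σ s).im) :
    HasSpiralingArms σ := by
  obtain ⟨s₀, h0⟩ := H.exists_eq_zero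
  refine ⟨s₀, fun s hs => ?_, ?_⟩
  · simp only [hypDist_axisPoint]
    rw [Real.arcosh_lt_arcosh (hσ.height_pos _) (hσ.height_pos _), hσ.height_eq_sqrt,
      hσ.height_eq_sqrt]
    exact Real.sqrt_lt_sqrt (by positivity) (by linarith [H.sq_add_sq_lt h0 hs])
  · rintro γ (rfl | rfl)
    · exact hσ.arm H h0
    · have Hr : IsTangentialSystem h (fun s => (framePosition (fun s => σ (-s)) s).re)
          (fun s => (framePosition (fun s => σ (-s)) s).im) := by
        simpa only [framePosition_reverse, Complex.neg_re, Complex.neg_im] using H.reverse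
      have := hσ.reverse.arm Hr (s₀ := -s₀) (by
        rw [framePosition_reverse, neg_neg, Complex.neg_re]
        exact neg_eq_zero.2 h0)
      simpa only [neg_add, neg_neg, ← sub_eq_add_neg] using this

end IsGeneratingCurve

end Arms

/-! ### Completeness of the induced metric. -/

section Completeness

variable {σ : ℝ → ℂ × ℝ} {h : ℝ}

/-- The first fundamental form of a helicoidal surface, in terms of the position components. -/
noncomputable def speedSq (h : ℝ) (σ : ℝ → ℂ × ℝ) (u a b : ℝ) : ℝ :=
  (a - b * (framePosition σ u).im) ^ 2 + (b * (framePosition σ u).re) ^ 2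
    - (deriv (fun x => (σ x).2) u * a) ^ 2 + (h * b) ^ 2

namespace IsGeneratingCurve

theorem deriv_height_sq_mul (hσ : IsGeneratingCurve σ) (u : ℝ) :
    deriv (fun x => (σ x).2) u ^ 2 * (1 + (framePosition σ u).re ^ 2 + (framePosition σ u).im ^ 2) =
      (framePosition σ u).re ^ 2 := by
  rw [← hσ.height_sq, ← hσ.deriv_height_mul]
  ring

theorem inner4_deriv_comp (hσ : IsGeneratingCurve σ) {γ : ℝ → ℝ × ℝ} {t a b : ℝ}
    (h1 : HasDerivAt (fun t => (γ t).1) a t) (h2 : HasDerivAt (fun t => (γ t).2) b t) :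
    inner4 (deriv (fun x => helicoidalSurface h σ (γ x)) t)
      (deriv (fun x => helicoidalSurface h σ (γ x)) t) = speedSq h σ (γ t).1 a b := by
  have hα : HasDerivAt (fun t => (σ (γ t).1).1) (a * planeTangent σ (γ t).1) t :=
    (HasDerivAt.scomp (g₁ := fun x => (σ x).1) (h := fun t => (γ t).1) t
      (hσ.hasDerivAt_plane (γ t).1) h1).congr_deriv Complex.real_smul
  have hφ : HasDerivAt (fun t => (σ (γ t).1).2) (deriv (fun x => (σ x).2) (γ t).1 * a) t :=
    HasDerivAt.comp (h₂ := fun x => (σ x).2) (h := fun t => (γ t).1) t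
      (hσ.hasDerivAt_height (γ t).1) h1
  have he : HasDerivAt (fun t => Complex.exp ((γ t).2 * Complex.I))
      (Complex.exp ((γ t).2 * Complex.I) * (b * Complex.I)) t :=
    ((h2.ofReal_comp).mul_const Complex.I).cexp
  have hX := ((he.mul hα).prodMk hφ).prodMk (h2.const_mul h)
  have hd : deriv (fun x => helicoidalSurface h σ (γ x)) t =
      (((a + b * Complex.I * framePosition σ (γ t).1) * surfaceTangent σ (γ t),
        deriv (fun x => (σ x).2) (γ t).1 * a), h * b) := by
    refine hX.deriv.trans ?_
    congr 2
    rw [surfaceTangent, ← hσ.framePosition_mul (γ t).1]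
    ring
  rw [hd, hσ.inner4_self, speedSq]
  simp
  ring

/-- The contribution of the ℍ² factor is nonnegative, since tangent vectors of the hyperboloid are
spacelike; `key` exhibits it as a sum of squares after multiplication by φ². -/
theorem pitch_mul_sq_le_speedSq (hσ : IsGeneratingCurve σ) (u a b : ℝ) :
    (h * b) ^ 2 ≤ speedSq h σ u a b := by
  have h1 := hσ.deriv_height_sq_mul u
  rw [speedSq]
  set x := (framePosition σ u).re
  set y := (framePosition σ u).im
  set p := deriv (fun x => (σ x).2) u
  have hpos : 0 < 1 + x ^ 2 + y ^ 2 := by positivity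
  have : 0 ≤ (a - b * y) ^ 2 + (b * x) ^ 2 - (p * a) ^ 2 := by
    refine nonneg_of_mul_nonneg_right (b := _) (a := 1 + x ^ 2 + y ^ 2) ?_ hpos
    have key : (1 + x ^ 2 + y ^ 2) * ((a - b * y) ^ 2 + (b * x) ^ 2 - (p * a) ^ 2) =
        (a - b * y) ^ 2 + (b * x) ^ 2 + (y * (a - b * y) - b * x ^ 2) ^ 2 := by
      linear_combination (-a ^ 2) * h1
    rw [key]
    positivity
  linarith

/-- Completing the square in b: G (E a² + 2F ab + G b²) = (G b + F a)² + (EG - F²) a², and EG - F² ≥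
min(1, h²). As G grows at most quadratically in u, this controls arsinh u. -/
theorem le_speedSq_mul (hσ : IsGeneratingCurve σ) (u a b : ℝ) :
    min 1 (h ^ 2) * a ^ 2 ≤ speedSq h σ u a b *
      ((framePosition σ u).re ^ 2 + (framePosition σ u).im ^ 2 + h ^ 2) := by
  have h1 := hσ.deriv_height_sq_mul u
  have h2 := min_mul_le (h := h) (framePosition σ u).re (framePosition σ u).im
  rw [speedSq]
  set x := (framePosition σ u).re
  set y := (framePosition σ u).im
  set p := deriv (fun x => (σ x).2) u
  have hpos : 0 < 1 + x ^ 2 + y ^ 2 := by positivity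
  refine le_of_mul_le_mul_left (a := 1 + x ^ 2 + y ^ 2) ?_ hpos
  have key : (1 + x ^ 2 + y ^ 2) * (((a - b * y) ^ 2 + (b * x) ^ 2 - (p * a) ^ 2 + (h * b) ^ 2) *
      (x ^ 2 + y ^ 2 + h ^ 2)) = (1 + x ^ 2 + y ^ 2) * ((x ^ 2 + y ^ 2 + h ^ 2) * b - y * a) ^ 2
        + (x ^ 2 + h ^ 2 * (1 + y ^ 2)) * a ^ 2 := by
    linear_combination (-a ^ 2 * (x ^ 2 + y ^ 2 + h ^ 2)) * h1
  rw [key]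
  have h3 : (min 1 (h ^ 2) * (1 + x ^ 2 + y ^ 2)) * a ^ 2 ≤ (x ^ 2 + h ^ 2 * (1 + y ^ 2)) * a ^ 2 :=
    mul_le_mul_of_nonneg_right h2 (sq_nonneg a)
  have h4 : 0 ≤ (1 + x ^ 2 + y ^ 2) * ((x ^ 2 + y ^ 2 + h ^ 2) * b - y * a) ^ 2 := by positivity
  linarith

theorem norm_plane_le (hσ : IsGeneratingCurve σ) (u : ℝ) : ‖(σ u).1‖ ≤ ‖(σ 0).1‖ + |u| := by
  have h1 : ‖(σ u).1 - (σ 0).1‖ ≤ 1 * ‖u - 0‖ :=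
    convex_univ.norm_image_sub_le_of_norm_deriv_le (f := fun x => (σ x).1)
      (fun x _ => (hσ.hasDerivAt_plane x).differentiableAt) (fun x _ => (hσ.arcLength x).le)
      (mem_univ _) (mem_univ _)
  have h2 := norm_sub_norm_le (σ u).1 (σ 0).1
  rw [sub_zero, one_mul, Real.norm_eq_abs] at h1
  linarith

/-- The lower bound of the induced metric by a complete metric of the line. -/
theorem arsinh_sq_le_speedSq (hσ : IsGeneratingCurve σ) (hh : 0 < h) (u a b : ℝ) :
    min 1 (h ^ 2) / (2 * ‖(σ 0).1‖ ^ 2 + h ^ 2 + 2) * ((√(1 + u ^ 2))⁻¹ * a) ^ 2 ≤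
      speedSq h σ u a b := by
  have h1 := hσ.le_speedSq_mul (h := h) u a b
  have h2 : (framePosition σ u).re ^ 2 + (framePosition σ u).im ^ 2 + h ^ 2 ≤
      (2 * ‖(σ 0).1‖ ^ 2 + h ^ 2 + 2) * (1 + u ^ 2) := by
    rw [← hσ.norm_plane_sq]
    have h3 : ‖(σ u).1‖ ^ 2 ≤ (‖(σ 0).1‖ + |u|) ^ 2 :=
      pow_le_pow_left₀ (norm_nonneg _) (hσ.norm_plane_le u) 2
    have h4 : 0 ≤ ‖(σ 0).1‖ ^ 2 * u ^ 2 := by positivity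
    have h5 : 0 ≤ h ^ 2 * u ^ 2 := by positivity
    nlinarith [sq_nonneg (‖(σ 0).1‖ - |u|), sq_abs u]
  have h0 : 0 ≤ speedSq h σ u a b := (sq_nonneg _).trans (hσ.pitch_mul_sq_le_speedSq u a b)
  have h6 := h1.trans (mul_le_mul_of_nonneg_left h2 h0)
  rw [mul_pow, inv_pow, Real.sq_sqrt (by positivity)]
  have h7 : min 1 (h ^ 2) / (2 * ‖(σ 0).1‖ ^ 2 + h ^ 2 + 2) * ((1 + u ^ 2)⁻¹ * a ^ 2) =
      min 1 (h ^ 2) * a ^ 2 / ((2 * ‖(σ 0).1‖ ^ 2 + h ^ 2 + 2) * (1 + u ^ 2)) := by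
    field_simp
  rw [h7, div_le_iff₀ (by positivity)]
  exact h6

theorem speedSq_le (u a b : ℝ) {M δ : ℝ} (hM : ‖framePosition σ u‖ ≤ M)
    (ha : |a| ≤ δ) (hb : |b| ≤ δ) : speedSq h σ u a b ≤ ((1 + M) ^ 2 + M ^ 2 + h ^ 2) * δ ^ 2 := by
  have hx := (Complex.abs_re_le_norm _).trans hM
  have hy := (Complex.abs_im_le_norm _).trans hM
  have hδ := (abs_nonneg a).trans ha
  have h1 : |a - b * (framePosition σ u).im| ≤ (1 + M) * δ := by
    refine (abs_sub _ _).trans ?_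
    rw [abs_mul]
    nlinarith [mul_le_mul hb hy (abs_nonneg _) hδ]
  have h2 : |b * (framePosition σ u).re| ≤ M * δ := by
    rw [abs_mul]
    nlinarith [mul_le_mul hb hx (abs_nonneg _) hδ]
  have h3 := pow_le_pow_left₀ (abs_nonneg _) h1 2
  have h4 := pow_le_pow_left₀ (abs_nonneg _) h2 2
  have h5 := pow_le_pow_left₀ (abs_nonneg _) hb 2
  rw [sq_abs] at h3 h4 h5
  rw [speedSq]
  nlinarith [sq_nonneg (deriv (fun x => (σ x).2) u * a), mul_le_mul_of_nonneg_left h5 (sq_nonneg h)]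

end IsGeneratingCurve

/-- A function on the parameter plane that is `1`-Lipschitz along paths is `1`-Lipschitz for the
intrinsic distance. -/
theorem ofReal_abs_sub_le_intrinsicDist {X : ℝ × ℝ → (ℂ × ℝ) × ℝ} {g : ℝ × ℝ → ℝ}
    (hg : ContDiff ℝ 1 g)
    (hle : ∀ γ : ℝ → ℝ × ℝ, ContDiff ℝ 1 γ → ∀ t, |deriv (fun t => g (γ t)) t| ≤
      √(inner4 (deriv (fun x => X (γ x)) t) (deriv (fun x => X (γ x)) t))) (p q : ℝ × ℝ) :
    ENNReal.ofReal |g p - g q| ≤ intrinsicDist X p q := by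
  refine le_iInf₂ fun γ ⟨hγ, hp, hq⟩ => ?_
  have hgγ : ContDiff ℝ 1 fun t => g (γ t) := hg.comp hγ
  have hint : IntervalIntegrable (deriv fun t => g (γ t)) MeasureTheory.volume 0 1 :=
    (hgγ.continuous_deriv le_rfl).intervalIntegrable 0 1
  have hftc : ∫ t in (0 : ℝ)..1, deriv (fun t => g (γ t)) t = g q - g p := by
    rw [intervalIntegral.integral_deriv_eq_sub
      (fun t _ => (hgγ.differentiable one_ne_zero) t) hint, hp, hq]
  rw [abs_sub_comm, ← hftc, intervalIntegral.integral_of_le zero_le_one, ← Real.norm_eq_abs,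
    ofReal_norm]
  refine (MeasureTheory.enorm_integral_le_lintegral_enorm _).trans ?_
  rw [inducedLength]
  refine (MeasureTheory.lintegral_mono_set Ioc_subset_Icc_self).trans
    (MeasureTheory.lintegral_mono fun t => ?_)
  rw [← ofReal_norm, Real.norm_eq_abs]
  exact ENNReal.ofReal_le_ofReal (hle γ hγ t)

theorem cauchySeq_comp_of_intrinsicDist {X : ℝ × ℝ → (ℂ × ℝ) × ℝ} {g : ℝ × ℝ → ℝ}
    (hg : ∀ p q, ENNReal.ofReal |g p - g q| ≤ intrinsicDist X p q) {x : ℕ → ℝ × ℝ}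
    (hx : ∀ ε : ℝ≥0∞, 0 < ε → ∃ N, ∀ m ≥ N, ∀ n ≥ N, intrinsicDist X (x m) (x n) < ε) :
    CauchySeq fun n => g (x n) := by
  refine Metric.cauchySeq_iff.2 fun ε hε => ?_
  obtain ⟨N, hN⟩ := hx (ENNReal.ofReal ε) (ENNReal.ofReal_pos.2 hε)
  refine ⟨N, fun m hm n hn => ?_⟩
  exact (ENNReal.ofReal_lt_ofReal_iff hε).1 ((hg _ _).trans_lt (hN m hm n hn))

namespace IsGeneratingCurve

theorem hasDerivAt_fst_snd {γ : ℝ → ℝ × ℝ} (hγ : ContDiff ℝ 1 γ) (t : ℝ) :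
    HasDerivAt (fun t => (γ t).1) (deriv γ t).1 t ∧
      HasDerivAt (fun t => (γ t).2) (deriv γ t).2 t := by
  have := (hγ.differentiable one_ne_zero t).hasDerivAt
  exact ⟨(ContinuousLinearMap.fst ℝ ℝ ℝ).hasFDerivAt.comp_hasDerivAt t this,
    (ContinuousLinearMap.snd ℝ ℝ ℝ).hasFDerivAt.comp_hasDerivAt t this⟩

/-- Uses the straight segment of the parameter plane as competitor; M bounds the plane position
along it because α has unit speed. -/
theorem intrinsicDist_le (hσ : IsGeneratingCurve σ) {p q : ℝ × ℝ} {M : ℝ}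
    (hM : ‖(σ 0).1‖ + |p.1| + |q.1 - p.1| ≤ M) : intrinsicDist (helicoidalSurface h σ) p q ≤
      ENNReal.ofReal (√((1 + M) ^ 2 + M ^ 2 + h ^ 2) * ‖q - p‖) := by
  let γ : ℝ → ℝ × ℝ := fun t => p + t • (q - p)
  have hγ : ContDiff ℝ 1 γ := contDiff_const.add (contDiff_id.smul contDiff_const)
  refine (iInf₂_le γ ⟨hγ, by simp [γ], by simp [γ]⟩).trans ?_
  rw [inducedLength]
  calc _ ≤ ∫⁻ _ in Icc (0 : ℝ) 1,
        ENNReal.ofReal (√((1 + M) ^ 2 + M ^ 2 + h ^ 2) * ‖q - p‖) := by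
        refine MeasureTheory.setLIntegral_mono' measurableSet_Icc fun t ht => ?_
        refine ENNReal.ofReal_le_ofReal ?_
        have h1 : HasDerivAt (fun t => (γ t).1) (q.1 - p.1) t := by
          simpa [γ] using ((hasDerivAt_id t).mul_const (q.1 - p.1)).const_add p.1
        have h2 : HasDerivAt (fun t => (γ t).2) (q.2 - p.2) t := by
          simpa [γ] using ((hasDerivAt_id t).mul_const (q.2 - p.2)).const_add p.2
        rw [hσ.inner4_deriv_comp h1 h2, ← Real.sqrt_sq (norm_nonneg (q - p)),
          ← Real.sqrt_mul (by positivity)]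
        refine Real.sqrt_le_sqrt (speedSq_le _ _ _ ?_ (norm_fst_le (q - p)) (norm_snd_le (q - p)))
        have hn : ‖framePosition σ (γ t).1‖ = ‖(σ (γ t).1).1‖ := by
          rw [← sq_eq_sq₀ (norm_nonneg _) (norm_nonneg _), hσ.norm_plane_sq, Complex.sq_norm,
            Complex.normSq_apply]
          ring
        rw [hn]
        refine (hσ.norm_plane_le _).trans (le_trans ?_ hM)
        have h3 : |(γ t).1| ≤ |p.1| + |t * (q.1 - p.1)| := abs_add_le _ _
        rw [abs_mul, abs_of_nonneg ht.1] at h3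
        nlinarith [abs_nonneg (q.1 - p.1), ht.2]
    _ = _ := by simp

theorem isCompleteSurface (hσ : IsGeneratingCurve σ) (hh : 0 < h) :
    IsCompleteSurface (helicoidalSurface h σ) := by
  intro x hx
  set κ := √(min 1 (h ^ 2) / (2 * ‖(σ 0).1‖ ^ 2 + h ^ 2 + 2)) with hκ
  have hκ0 : 0 < κ := Real.sqrt_pos.2 (by positivity)
  have hκ2 : κ ^ 2 = min 1 (h ^ 2) / (2 * ‖(σ 0).1‖ ^ 2 + h ^ 2 + 2) :=
    Real.sq_sqrt (by positivity)
  -- The factor κ makes this function 1-Lipschitz for the intrinsic distance; as arsinh is a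
  -- homeomorphism of the line, the u-coordinates converge.
  have hU : CauchySeq fun n => κ * Real.arsinh (x n).1 := by
    refine cauchySeq_comp_of_intrinsicDist (g := fun p => κ * Real.arsinh p.1)
      (ofReal_abs_sub_le_intrinsicDist
        (contDiff_const.mul (Real.contDiff_arsinh.comp contDiff_fst)) fun γ hγ t => ?_) hx
    obtain ⟨h1, h2⟩ := hasDerivAt_fst_snd hγ t
    rw [hσ.inner4_deriv_comp h1 h2, (h1.arsinh.const_mul κ).deriv]
    refine Real.abs_le_sqrt ?_
    rw [mul_pow, hκ2]
    exact hσ.arsinh_sq_le_speedSq hh _ _ _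
  have hV : CauchySeq fun n => h * (x n).2 := by
    refine cauchySeq_comp_of_intrinsicDist (g := fun p => h * p.2)
      (ofReal_abs_sub_le_intrinsicDist (contDiff_const.mul contDiff_snd) fun γ hγ t => ?_) hx
    obtain ⟨h1, h2⟩ := hasDerivAt_fst_snd hγ t
    rw [hσ.inner4_deriv_comp h1 h2, (h2.const_mul h).deriv]
    exact Real.abs_le_sqrt (hσ.pitch_mul_sq_le_speedSq _ _ _)
  obtain ⟨a, ha⟩ := cauchySeq_tendsto_of_complete hU
  obtain ⟨b, hb⟩ := cauchySeq_tendsto_of_complete hV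
  have ha' : Tendsto (fun n => (x n).1) atTop (𝓝 (Real.sinh (κ⁻¹ * a))) := by
    have := (Real.continuous_sinh.tendsto _).comp (ha.const_mul κ⁻¹)
    simpa [Function.comp_def, inv_mul_cancel_left₀ hκ0.ne'] using this
  have hb' : Tendsto (fun n => (x n).2) atTop (𝓝 (h⁻¹ * b)) := by
    simpa [inv_mul_cancel_left₀ hh.ne'] using hb.const_mul h⁻¹
  set p : ℝ × ℝ := (Real.sinh (κ⁻¹ * a), h⁻¹ * b) with hp
  have hlim : Tendsto x atTop (𝓝 p) := ha'.prodMk_nhds hb'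
  refine ⟨p, ?_⟩
  have hnorm : Tendsto (fun n => ‖p - x n‖) atTop (𝓝 0) := by
    simpa using ((tendsto_const_nhds (x := p)).sub hlim).norm
  -- Eventually x n is within 1 of p: |p.1| + 1 bounds its first coordinate, and the last 1 bounds
  -- the first-coordinate length of the segment to p.
  set M := ‖(σ 0).1‖ + (|p.1| + 1) + 1
  have hbound : Tendsto (fun n => ENNReal.ofReal
      (√((1 + M) ^ 2 + M ^ 2 + h ^ 2) * ‖p - x n‖)) atTop (𝓝 0) := by
    have := ENNReal.tendsto_ofReal (hnorm.const_mul (√((1 + M) ^ 2 + M ^ 2 + h ^ 2)))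
    simpa only [mul_zero, ENNReal.ofReal_zero] using this
  refine tendsto_of_tendsto_of_tendsto_of_le_of_le' tendsto_const_nhds hbound
    (Eventually.of_forall fun n => zero_le) ?_
  filter_upwards [hnorm.eventually (ge_mem_nhds one_pos)] with n hn
  refine hσ.intrinsicDist_le ?_
  have h1 : |p.1 - (x n).1| ≤ 1 := (norm_fst_le (p - x n)).trans hn
  have h2 := abs_sub_abs_le_abs_sub (x n).1 p.1
  rw [abs_sub_comm] at h2
  simp only [M]
  linarith

end IsGeneratingCurve

end Completeness

end HelicoidalRotator

theorem theorem1 (h : ℝ) (hh : 0 < h) :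
    (∃ σ : ℝ≥0 → ℝ → ℂ × ℝ,
      Continuous (fun p : ℝ≥0 × ℝ => σ p.1 p.2) ∧
      ∀ c : ℝ≥0,
        HelicoidalRotator.IsGeneratingCurve (σ c) ∧
        HelicoidalRotator.IsRotator (HelicoidalRotator.helicoidalSurface h (σ c)) ∧
        IsLeast (Set.range fun s =>
          HelicoidalRotator.hypDist HelicoidalRotator.axisPoint (σ c s)) (c : ℝ)) ∧
    ∀ σ : ℝ → ℂ × ℝ,
      HelicoidalRotator.IsGeneratingCurve σ →
      HelicoidalRotator.IsRotator (HelicoidalRotator.helicoidalSurface h σ) →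
        HelicoidalRotator.IsCompleteSurface (HelicoidalRotator.helicoidalSurface h σ) ∧
        HelicoidalRotator.HasSpiralingArms σ :=
  ⟨HelicoidalRotator.exists_family hh, fun _ hσ hX =>
    ⟨hσ.isCompleteSurface hh, hσ.hasSpiralingArms (hσ.isTangentialSystem hh hX)⟩⟩
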